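/- Let $\mathfrak H$ be a real separable Hilbert space and let $X=\{X(h):h\in\mathfrak H\}$ be a centered isonormal Gaussian process over $\mathfrak H$ on a probability space $(\Omega,\mathscr F,P)$, i.e. a centered, jointly Gaussian family with $E(X(h)X(k))=\langle h,k\rangle_{\mathfrak H}$ for all $h,k\in\mathfrak H$. Let $D$ be the Malliavin derivative: it is the closure, as an operator from $L^2(\Omega)$ to $L^2(\Omega;\mathfrak H)$, of $$D\,f(X(\phi_1),\dots,X(\phi_n))=\sum_{i=1}^n\partial_i f(X(\phi_1),\dots,X(\phi_n))\,\phi_i,$$ where $n\ge 1$, $f:\mathbb R^n\to\mathbb R$ is smooth with compact support and $\phi_i\in\mathfrak H$; its domain is denoted $\mathbb D^{1,2}$. Let $J_m$ be the orthogonal projection of $L^2(\Omega)$ onto the $m$-th Wiener chaos of $X$ (for $m\ge1$, the closed linear span of the variables $H_m(X(h))$ with $\|h\|_{\mathfrak H}=1$, where $H_m$ is the $m$-th Hermite polynomial), and let $L^{-1}F=-\sum_{m\ge1}\frac1m J_mF$ be the pseudo-inverse of the generator of the Ornstein–Uhlenbeck semigroup. **Theorem.** Let $Z\in\mathbb D^{1,2}$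 have mean zero, and let the Borel function $g:\mathbb R\to\mathbb R$ be a version of $g(z)=E\big(\langle DZ,-DL^{-1}Z\rangle_{\mathfrak H}\,\big|\,Z=z\big)$. Assume that there is $\sigma_{\min}>0$ such that $g(Z)\ge\sigma_{\min}^2$ almost surely. Then the law of $Z$ has a density $\rho$ with respect to Lebesgue measure, and its support is $\mathbb R$. Moreover $g(z)>0$ for almost every $z\in\mathbb R$, the function $x\mapsto x/g(x)$ is integrable on every bounded interval, and for almost every $z\in\mathbb R$ $$\rho(z)=\frac{E|Z|}{2g(z)}\exp\left(-\int_0^z\frac{x\,dx}{g(x)}\right).$$ Furthermore, $y\mapsto y\rho(y)$ is integrable on $\mathbb R$, and almost surely $\rho(Z)>0$ and $$g(Z)=\frac{\int_Z^\infty y\rho(y)\,dy}{\rho(Z)}.$$ -/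

import Mathlib

open MeasureTheory ProbabilityTheory Set Filter Topology
open scoped ENNReal

noncomputable section

namespace GaussDensity

section Malliavin

variable {H : Type*} [NormedAddCommGroup H] [InnerProductSpace ℝ H]
variable {Ω : Type*} [MeasurableSpace Ω]

/-- `X` is a centered isonormal Gaussian process over the Hilbert space `H`, defined on the
probability space `(Ω, P)`: a family of centered, jointly Gaussian random variables with
covariance `E(X(h) X(k)) = ⟪h, k⟫`. -/
structure IsIsonormal (X : H → Ω → ℝ) (P : Measure Ω) : Prop where
  isGaussian : IsGaussianProcess X P
  centered : ∀ h, ∫ ω, X h ω ∂P = 0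
  covariance : ∀ h k, ∫ ω, X h ω * X k ω ∂P = inner ℝ h k

/-- The pairs `(F, DF) ∈ L²(Ω) × L²(Ω; H)`, where `F = f(X(φ₁), …, X(φₙ))` is a smooth cylindrical
random variable (`n ≥ 1` and `f` smooth with compact support) and
`DF = ∑ i, ∂ᵢf(X(φ₁), …, X(φₙ)) φᵢ`. -/
def smoothPairs (X : H → Ω → ℝ) (P : Measure Ω) : Set (Lp ℝ 2 P × Lp H 2 P) :=
  {p | ∃ (n : ℕ) (f : (Fin n → ℝ) → ℝ) (φ : Fin n → H),
    1 ≤ n ∧ ContDiff ℝ (⊤ : ℕ∞) f ∧ HasCompactSupport f ∧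
    (p.1 =ᵐ[P] fun ω => f (fun j => X (φ j) ω)) ∧
    (p.2 =ᵐ[P] fun ω =>
      ∑ i, (fderiv ℝ f (fun j => X (φ j) ω) (Pi.single i (1 : ℝ))) • φ i)}

/-- The graph of the (closed) Malliavin derivative operator `D : L²(Ω) → L²(Ω; H)`: the closure
of the graph of `D` on smooth cylindrical random variables. -/
def malliavinGraph (X : H → Ω → ℝ) (P : Measure Ω) : Set (Lp ℝ 2 P × Lp H 2 P) :=
  closure (smoothPairs X P)

/-- The space `𝔻^{1,2}`, the domain of the Malliavin derivative: the closure of the smooth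
cylindrical random variables for the norm `(E(F²) + E‖DF‖²)^{1/2}`. -/
def D12 (X : H → Ω → ℝ) (P : Measure Ω) : Set (Lp ℝ 2 P) :=
  {F | ∃ U : Lp H 2 P, (F, U) ∈ malliavinGraph X P}

open Classical in
/-- The Malliavin derivative `DF ∈ L²(Ω; H)` of `F ∈ 𝔻^{1,2}` (and `0` for other `F`). -/
def malliavinD (X : H → Ω → ℝ) (P : Measure Ω) (F : Lp ℝ 2 P) : Lp H 2 P :=
  if h : ∃ U : Lp H 2 P, (F, U) ∈ malliavinGraph X P then h.choose else 0

/-- The `m`-th Wiener chaos of `X`: the closed linear subspace of `L²(Ω)` spanned by the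
constants if `m = 0`, and by the variables `Hₘ(X(h))` with `‖h‖ = 1` if `m ≥ 1`, where `Hₘ` is the
`m`-th Hermite polynomial. -/
def wienerChaos (X : H → Ω → ℝ) (P : Measure Ω) : ℕ → Submodule ℝ (Lp ℝ 2 P)
  | 0 => (Submodule.span ℝ {F : Lp ℝ 2 P | F =ᵐ[P] fun _ => (1 : ℝ)}).topologicalClosure
  | m + 1 => (Submodule.span ℝ {F : Lp ℝ 2 P | ∃ h : H, ‖h‖ = 1 ∧
      F =ᵐ[P] fun ω => Polynomial.aeval (X h ω) (Polynomial.hermite (m + 1))}).topologicalClosure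

instance instCompleteSpaceWienerChaos (X : H → Ω → ℝ) (P : Measure Ω) (m : ℕ) :
    CompleteSpace (wienerChaos X P m) := by
  cases m <;> exact Submodule.topologicalClosure.completeSpace _

/-- The orthogonal projection `J_m` of `L²(Ω)` onto the `m`-th Wiener chaos. -/
def chaosProj (X : H → Ω → ℝ) (P : Measure Ω) (m : ℕ) : Lp ℝ 2 P →L[ℝ] Lp ℝ 2 P :=
  (wienerChaos X P m).starProjection

/-- The pseudo-inverse `L⁻¹F = ∑_{m ≥ 1} -(1/m) J_m(F)` of the generator of the
Ornstein-Uhlenbeck semigroup; the series converges in `L²(Ω)`, its terms being pairwise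
orthogonal. -/
def ouInv (X : H → Ω → ℝ) (P : Measure Ω) (F : Lp ℝ 2 P) : Lp ℝ 2 P :=
  ∑' m : ℕ, (-(1 / ((m : ℝ) + 1))) • chaosProj X P (m + 1) F

/-- The random variable `⟪DF, -DL⁻¹F⟫`. -/
def steinInner (X : H → Ω → ℝ) (P : Measure Ω) (F : Lp ℝ 2 P) (ω : Ω) : ℝ :=
  inner ℝ (malliavinD X P F ω) (-(malliavinD X P (ouInv X P F) ω))

end Malliavin

section Conditioning

variable {Ω : Type*} [MeasurableSpace Ω]

/-- The Borel function `g` is a version of `z ↦ E(Y | Z = z)`. -/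
def IsCondExpGiven (P : Measure Ω) (Y Z : Ω → ℝ) (g : ℝ → ℝ) : Prop :=
  Measurable g ∧
    (fun ω => g (Z ω)) =ᵐ[P] P[Y | MeasurableSpace.comap Z inferInstance]

/-- A version of `z ↦ E(Y | Z = z)` always exists. -/
theorem exists_isCondExpGiven (P : Measure Ω) (Y Z : Ω → ℝ) :
    ∃ g, IsCondExpGiven P Y Z g := by
  have hm : StronglyMeasurable[MeasurableSpace.comap Z inferInstance]
      (P[Y | MeasurableSpace.comap Z inferInstance]) := stronglyMeasurable_condExp
  obtain ⟨g, hg, h⟩ := hm.exists_eq_measurable_comp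
  exact ⟨g, hg.measurable, Eq.eventuallyEq h.symm⟩

/-- `ρ` is a density (with respect to Lebesgue measure) of the law of `Z`. -/
def IsDensity (P : Measure Ω) (Z : Ω → ℝ) (ρ : ℝ → ℝ) : Prop :=
  Measurable ρ ∧ (∀ z, 0 ≤ ρ z) ∧
    P.map Z = (volume : Measure ℝ).withDensity (fun z => ENNReal.ofReal (ρ z))

end Conditioning

end GaussDensity

end

/-! Everything rests on the integration by parts formula `E(u'(Z) g(Z)) = E(u(Z) Z)` for smooth `u`
with `u 0 = 0` and bounded derivative, followed by an argument about the law `μ` of `Z` on the line.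

The formula says that `D* D (-L⁻¹ Z) = Z`, tested against `u(Z)` with the chain rule. Gaussian
integration by parts on cylindrical variables makes `D` closable and shows that `D* D` acts on the
`m`-th chaos as multiplication by `m` (`wienerChaos_le_adjointEigenspace`). Hence the chaoses are
orthogonal, and `-L⁻¹` inverts `D* D` on their sum (`exists_adjoint_inverse`). What is left of `Z`
after projection is orthogonal to all chaoses, hence to the domain of `D`, by a Fourier argument
(`integral_mul_cylinder_eq_zero`). This gives `inner_neg_malliavinD_ouInv`; conditioning on `Z` then
gives `integral_deriv_mul_condExp`.

On the line, put `Ψ(x) = ∫_{[x, ∞)} z dμ(z)`. Fubini gives `E(u(Z) Z) = ∫ u' Ψ dx`, so the measures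
`g μ` and `Ψ dx` integrate sines and cosines alike and coincide. Since `g ≥ σ²` almost everywhere
for `μ`, the law has a density `ρ`, and `g ρ = Ψ`. Now `Ψ' = -x ρ = -(x / g) Ψ` in integrated form
and `Ψ 0 = E|Z| / 2`; solving this linear equation gives the formula for `ρ`. The solution never
vanishes, so `ρ > 0` almost everywhere and the support is the whole line. -/

noncomputable section

namespace GaussDensity

/-! ### Dominated convergence in `L²` -/

section DominatedConvergence

variable {Ω : Type*} [MeasurableSpace Ω] {P : Measure Ω}
variable {E : Type*} [NormedAddCommGroup E]

/-- Dominated convergence in `L²`. -/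
theorem tendsto_toLp_two_of_dominated {F : ℕ → Ω → E} {G : Ω → E} {B : Ω → ℝ}
    (hF : ∀ k, MemLp (F k) 2 P) (hG : MemLp G 2 P) (hB : MemLp B 2 P)
    (bound : ∀ k, ∀ᵐ ω ∂P, ‖F k ω‖ ≤ B ω)
    (lim : ∀ᵐ ω ∂P, Tendsto (fun k => F k ω) atTop (𝓝 (G ω))) :
    Tendsto (fun k => (hF k).toLp (F k)) atTop (𝓝 (hG.toLp G)) := by
  rw [Lp.tendsto_Lp_iff_tendsto_eLpNorm'']
  have key : Tendsto (fun k => ∫⁻ ω, ‖F k ω - G ω‖ₑ ^ (2 : ℝ) ∂P) atTop (𝓝 0) := by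
    have h0 : (∫⁻ _ : Ω, (0 : ℝ≥0∞) ∂P) = 0 := by simp
    rw [← h0]
    have hBG : MemLp (fun ω => B ω + ‖G ω‖) 2 P := hB.add hG.norm
    refine tendsto_lintegral_of_dominated_convergence' (fun ω => ‖B ω + ‖G ω‖‖ₑ ^ (2 : ℝ))
      (fun k => ((hF k).sub hG).aestronglyMeasurable.enorm.pow_const _) (fun k => ?_) ?_ ?_
    · filter_upwards [bound k] with ω hω
      gcongr
      rw [enorm_le_iff_norm_le]
      refine (norm_sub_le _ _).trans ?_
      rw [Real.norm_eq_abs]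
      exact (add_le_add_left hω _).trans (le_abs_self _)
    · have := (eLpNorm_lt_top_iff_lintegral_rpow_enorm_lt_top (p := 2) (by simp) (by simp)).1 hBG.2
      simpa using this.ne
    · filter_upwards [lim] with ω hω
      have h1 : Tendsto (fun k => ‖F k ω - G ω‖ₑ) atTop (𝓝 0) := by
        have : Tendsto (fun k => F k ω - G ω) atTop (𝓝 0) := by
          simpa using hω.sub_const (G ω)
        simpa using this.enorm
      have := (ENNReal.continuous_rpow_const (y := (2 : ℝ))).continuousAt.tendsto.comp h1
      simpa [Function.comp_def] using this
  have h2 := ((ENNReal.continuous_rpow_const (y := (1 / 2 : ℝ))).continuousAt (x := 0)).tendsto.comp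
    key
  refine Tendsto.congr (fun k => ?_) (by simpa using h2)
  rw [eLpNorm_eq_lintegral_rpow_enorm_toReal (by simp) (by simp)]
  simp

end DominatedConvergence

/-! ### Stein's identity in dimension one -/

section SteinIdentity

theorem hasDerivAt_gaussianPDFReal_zero_one (x : ℝ) :
    HasDerivAt (gaussianPDFReal 0 1) (-x * gaussianPDFReal 0 1 x) x := by
  have h : gaussianPDFReal 0 1 = fun x => (√(2 * Real.pi))⁻¹ * Real.exp (-x ^ 2 / 2) := by
    ext y; simp [gaussianPDFReal]
  rw [h]
  have h1 : HasDerivAt (fun x : ℝ => -x ^ 2 / 2) (-x) x := by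
    have := ((hasDerivAt_pow 2 x).neg).div_const 2
    convert! this using 1
    simp; ring
  convert! (h1.exp.const_mul (√(2 * Real.pi))⁻¹) using 1
  ring

theorem integrable_gaussianReal_iff {f : ℝ → ℝ} :
    Integrable f (gaussianReal 0 1) ↔ Integrable (fun x => gaussianPDFReal 0 1 x * f x) := by
  rw [gaussianReal_of_var_ne_zero _ one_ne_zero,
    integrable_withDensity_iff_integrable_smul' (measurable_gaussianPDF _ _)
      (ae_of_all _ fun _ => gaussianPDF_lt_top)]
  simp

/-- Stein's identity for the standard Gaussian law on `ℝ`. -/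
theorem integral_mul_gaussianReal {f f' : ℝ → ℝ} (hf : ∀ x, HasDerivAt f (f' x) x)
    (hfi : Integrable f (gaussianReal 0 1)) (hf'i : Integrable f' (gaussianReal 0 1))
    (hxf : Integrable (fun x => f x * x) (gaussianReal 0 1)) :
    ∫ x, f x * x ∂gaussianReal 0 1 = ∫ x, f' x ∂gaussianReal 0 1 := by
  rw [integrable_gaussianReal_iff] at hfi hf'i hxf
  rw [integral_gaussianReal_eq_integral_smul one_ne_zero,
    integral_gaussianReal_eq_integral_smul one_ne_zero]
  have := integral_mul_deriv_eq_deriv_mul_of_integrable (u := f) (u' := f')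
    (v := gaussianPDFReal 0 1) (v' := fun x => -x * gaussianPDFReal 0 1 x)
    (fun x _ => hf x) (fun x _ => hasDerivAt_gaussianPDFReal_zero_one x)
    (by refine hxf.neg.congr (ae_of_all _ fun x => ?_); simp; ring)
    (by refine hf'i.congr (ae_of_all _ fun x => ?_); simp; ring)
    (by refine hfi.congr (ae_of_all _ fun x => ?_); simp; ring)
  simp only [smul_eq_mul]
  calc ∫ x, gaussianPDFReal 0 1 x * (f x * x)
      = -∫ x, f x * (-x * gaussianPDFReal 0 1 x) := by
        rw [← integral_neg]; congr 1; ext x; ring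
    _ = ∫ x, f' x * gaussianPDFReal 0 1 x := by rw [this, neg_neg]
    _ = _ := by congr 1; ext x; ring

end SteinIdentity

/-! ### Isonormal processes: linearity, independence, integration by parts -/

section Isonormal

variable {H : Type*} [NormedAddCommGroup H] [InnerProductSpace ℝ H]
variable {Ω : Type*} [MeasurableSpace Ω] {P : Measure Ω} {X : H → Ω → ℝ}

namespace IsIsonormal

theorem isProbabilityMeasure (hX : IsIsonormal X P) : IsProbabilityMeasure P :=
  hX.isGaussian.isProbabilityMeasure

theorem aemeasurable (hX : IsIsonormal X P) (h : H) : AEMeasurable (X h) P :=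
  hX.isGaussian.aemeasurable h

theorem aemeasurable_pi (hX : IsIsonormal X P) {ι : Type*} [Countable ι] (φ : ι → H) :
    AEMeasurable (fun ω i => X (φ i) ω) P :=
  aemeasurable_pi_lambda _ fun i => hX.aemeasurable (φ i)

theorem memLp (hX : IsIsonormal X P) (h : H) {p : ℝ≥0∞} (hp : p ≠ ∞) : MemLp (X h) p P :=
  (hX.isGaussian.hasGaussianLaw_eval h).memLp hp

/-- Linearity is not part of the definition: the covariance makes `h ↦ X h` preserve inner products,
so the `L²` norm of the difference of the two sides expands to zero. -/
theorem map_sum_smul (hX : IsIsonormal X P) {ι : Type*} [Fintype ι] (c : ι → ℝ) (φ : ι → H) :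
    X (∑ i, c i • φ i) =ᵐ[P] fun ω => ∑ i, c i * X (φ i) ω := by
  let ξ : H → Lp ℝ 2 P := fun h => (hX.memLp h (p := 2) (by simp)).toLp (X h)
  have hξ : ∀ h k, inner ℝ (ξ h) (ξ k) = inner ℝ h k := fun h k => by
    rw [L2.inner_def, ← hX.covariance]
    refine integral_congr_ae ?_
    filter_upwards [(hX.memLp h (p := 2) (by simp)).coeFn_toLp,
      (hX.memLp k (p := 2) (by simp)).coeFn_toLp] with ω h1 h2
    simp only [ξ]
    rw [h1, h2]; simp [mul_comm]
  have hz : ξ (∑ i, c i • φ i) - ∑ i, c i • ξ (φ i) = 0 := by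
    rw [← inner_self_eq_zero (𝕜 := ℝ)]
    simp only [inner_sub_left, inner_sub_right, inner_sum, sum_inner, inner_smul_left,
      inner_smul_right, hξ]
    simp [real_inner_comm]
  have h1 := (hX.memLp (∑ i, c i • φ i) (p := 2) (by simp)).coeFn_toLp
  have h2 : (ξ (∑ i, c i • φ i) : Ω → ℝ) =ᵐ[P] fun ω => ∑ i, (c i • ξ (φ i)) ω := by
    rw [sub_eq_zero.1 hz]
    exact Lp.coeFn_finsetSum _ _ |>.trans (ae_of_all _ fun ω => by simp)
  have h3 : ∀ᵐ ω ∂P, ∀ i, (c i • ξ (φ i)) ω = c i * X (φ i) ω := by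
    rw [ae_all_iff]; intro i
    filter_upwards [Lp.coeFn_smul (c i) (ξ (φ i)),
      (hX.memLp (φ i) (p := 2) (by simp)).coeFn_toLp] with ω h1 h2
    rw [h1, Pi.smul_apply, h2, smul_eq_mul]
  filter_upwards [h1, h2, h3] with ω h1 h2 h3
  rw [← h1]
  refine h2.trans (Finset.sum_congr rfl fun i _ => h3 i)

theorem map_smul_add (hX : IsIsonormal X P) (c : ℝ) (h k : H) :
    X (c • h + k) =ᵐ[P] fun ω => c * X h ω + X k ω := by
  have := hX.map_sum_smul ![c, 1] ![h, k]
  simpa using this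

theorem map_smul (hX : IsIsonormal X P) (c : ℝ) (h : H) :
    X (c • h) =ᵐ[P] fun ω => c * X h ω := by
  have := hX.map_sum_smul ![c] ![h]
  simpa using this

theorem map_eq_gaussianReal (hX : IsIsonormal X P) {h : H} (hh : ‖h‖ = 1) :
    P.map (X h) = gaussianReal 0 1 := by
  have := hX.isProbabilityMeasure
  have hg := (hX.isGaussian.hasGaussianLaw_eval h).map_eq_gaussianReal
  rw [hX.centered] at hg
  have hv : Var[X h; P] = 1 := by
    rw [variance_of_integral_eq_zero (hX.aemeasurable h) (hX.centered h)]
    have := hX.covariance h h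
    simp only [real_inner_self_eq_norm_sq, hh] at this
    simpa [sq] using this
  rw [hg, hv]; simp

/-- Uncorrelated jointly Gaussian families are independent. -/
theorem indepFun_of_inner_eq_zero (hX : IsIsonormal X P) {ι : Type*} {h : H} {ψ : ι → H}
    (hψ : ∀ i, inner ℝ h (ψ i) = 0) :
    IndepFun (X h) (fun ω i => X (ψ i) ω) P := by
  have := hX.isProbabilityMeasure
  have h1 : IsGaussianProcess (Sum.elim (fun _ : Unit => X h) fun i => X (ψ i)) P := by
    have h0 := hX.isGaussian.comp_right (Sum.elim (fun _ : Unit => h) ψ)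
    have h1 : X ∘ Sum.elim (fun _ : Unit => h) ψ =
        Sum.elim (fun _ : Unit => X h) fun i => X (ψ i) := by
      ext s; cases s <;> rfl
    rwa [h1] at h0
  have h2 := h1.indepFun_of_covariance_eq_zero (fun _ => hX.aemeasurable h)
    (fun i => hX.aemeasurable (ψ i)) fun _ i => by
      rw [covariance_eq_sub (hX.memLp h (by simp)) (hX.memLp _ (by simp))]
      simp [hX.centered, hX.covariance, hψ]
  exact h2.comp (measurable_pi_apply ()) measurable_id

/-- Gaussian integration by parts in a unit direction. -/
theorem integral_mul_of_norm_eq_one (hX : IsIsonormal X P) {n : ℕ} {f : (Fin n → ℝ) → ℝ}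
    (hf : ContDiff ℝ 1 f) {C C' : ℝ} (hC : ∀ x, ‖f x‖ ≤ C) (hC' : ∀ x, ‖fderiv ℝ f x‖ ≤ C')
    (φ : Fin n → H) {h : H} (hh : ‖h‖ = 1) :
    ∫ ω, f (fun j => X (φ j) ω) * X h ω ∂P =
      ∫ ω, fderiv ℝ f (fun j => X (φ j) ω) (fun j => inner ℝ (φ j) h) ∂P := by
  have := hX.isProbabilityMeasure
  -- Split `φ j = a j • h + ψ j` with `ψ j` orthogonal to `h`. Then `X h` is standard Gaussian and
  -- independent of the `X (ψ j)`; with the latter frozen, the claim is the one-dimensional Stein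
  -- identity for `u ↦ f (u • a + y)`.
  set a : Fin n → ℝ := fun j => inner ℝ (φ j) h with ha
  set ψ : Fin n → H := fun j => φ j - a j • h with hψ
  have horth : ∀ i, inner ℝ h (ψ i) = 0 := fun i => by
    simp [hψ, ha, inner_sub_right, inner_smul_right, hh,
      real_inner_comm]
  have hind := hX.indepFun_of_inner_eq_zero horth
  set Y : Ω → Fin n → ℝ := fun ω i => X (ψ i) ω with hY
  have hYm : AEMeasurable Y P := hX.aemeasurable_pi ψ
  have hdec : ∀ᵐ ω ∂P, (fun j => X (φ j) ω) = X h ω • a + Y ω := by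
    have : ∀ᵐ ω ∂P, ∀ j, X (φ j) ω = a j * X h ω + X (ψ j) ω := by
      rw [ae_all_iff]; intro j
      have := hX.map_smul_add (a j) h (ψ j)
      simp only [hψ, add_sub_cancel] at this
      exact this
    filter_upwards [this] with ω hω
    ext j; simp [hω, hY, mul_comm]
  rw [indepFun_iff_map_prod_eq_prod_map_map (hX.aemeasurable h) hYm,
    hX.map_eq_gaussianReal hh] at hind
  set ν := P.map Y with hν
  have : IsProbabilityMeasure ν := Measure.isProbabilityMeasure_map hYm
  have hjm : AEMeasurable (fun ω => (X h ω, Y ω)) P := (hX.aemeasurable h).prodMk hYm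
  have hfc : Continuous f := hf.continuous
  have hf'c : Continuous (fderiv ℝ f) := hf.continuous_fderiv one_ne_zero
  have hlhs : ∫ ω, f (fun j => X (φ j) ω) * X h ω ∂P =
      ∫ p, f (p.1 • a + p.2) * p.1 ∂((gaussianReal 0 1).prod ν) := by
    rw [← hind, integral_map hjm (Continuous.aestronglyMeasurable (by fun_prop))]
    refine integral_congr_ae ?_
    filter_upwards [hdec] with ω hω
    rw [hω]
  have hrhs : ∫ ω, fderiv ℝ f (fun j => X (φ j) ω) a ∂P =
      ∫ p, fderiv ℝ f (p.1 • a + p.2) a ∂((gaussianReal 0 1).prod ν) := by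
    rw [← hind, integral_map hjm (Continuous.aestronglyMeasurable (by fun_prop))]
    refine integral_congr_ae ?_
    filter_upwards [hdec] with ω hω
    rw [hω]
  have hid : Integrable (fun x : ℝ => x) (gaussianReal 0 1) :=
    (memLp_id_gaussianReal (μ := 0) (v := 1) 1).integrable (by simp)
  have i1 : Integrable (fun p : ℝ × (Fin n → ℝ) => f (p.1 • a + p.2) * p.1)
      ((gaussianReal 0 1).prod ν) := by
    refine (hid.comp_fst ν).bdd_mul (c := C) (Continuous.aestronglyMeasurable (by fun_prop))
      (ae_of_all _ fun p => hC _)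
  have hb : ∀ x, ‖fderiv ℝ f x a‖ ≤ C' * ‖a‖ := fun x =>
    ((fderiv ℝ f x).le_opNorm a).trans (by gcongr; exact hC' x)
  have i2 : Integrable (fun p : ℝ × (Fin n → ℝ) => fderiv ℝ f (p.1 • a + p.2) a)
      ((gaussianReal 0 1).prod ν) :=
    Integrable.of_bound (Continuous.aestronglyMeasurable (by fun_prop)) (C' * ‖a‖)
      (ae_of_all _ fun p => hb _)
  rw [hlhs, hrhs, integral_prod_symm _ i1, integral_prod_symm _ i2]
  congr 1; ext y
  refine integral_mul_gaussianReal (f := fun u => f (u • a + y))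
    (f' := fun u => fderiv ℝ f (u • a + y) a) (fun u => ?_) ?_ ?_ ?_
  · have h1 : HasDerivAt (fun u : ℝ => u • a + y) a u := by
      simpa using ((hasDerivAt_id u).smul_const a).add_const y
    exact ((hf.differentiable one_ne_zero _).hasFDerivAt.comp_hasDerivAt u h1)
  · exact Integrable.of_bound (Continuous.aestronglyMeasurable (by fun_prop)) C
      (ae_of_all _ fun p => hC _)
  · exact Integrable.of_bound (Continuous.aestronglyMeasurable (by fun_prop)) (C' * ‖a‖)
      (ae_of_all _ fun p => hb _)
  · exact hid.bdd_mul (c := C) (Continuous.aestronglyMeasurable (by fun_prop))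
      (ae_of_all _ fun p => hC _)

/-- Gaussian integration by parts. -/
theorem integral_mul_eq (hX : IsIsonormal X P) {n : ℕ} {f : (Fin n → ℝ) → ℝ}
    (hf : ContDiff ℝ 1 f) {C C' : ℝ} (hC : ∀ x, ‖f x‖ ≤ C) (hC' : ∀ x, ‖fderiv ℝ f x‖ ≤ C')
    (φ : Fin n → H) (h : H) :
    ∫ ω, f (fun j => X (φ j) ω) * X h ω ∂P =
      ∫ ω, fderiv ℝ f (fun j => X (φ j) ω) (fun j => inner ℝ (φ j) h) ∂P := by
  obtain ⟨e, c, he, rfl⟩ | rfl : (∃ (e : H) (c : ℝ), ‖e‖ = 1 ∧ h = c • e) ∨ h = 0 := by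
    by_cases h0 : h = 0
    · exact Or.inr h0
    · refine Or.inl ⟨‖h‖⁻¹ • h, ‖h‖, ?_, ?_⟩
      · rw [norm_smul, norm_inv, norm_norm, inv_mul_cancel₀ (norm_ne_zero_iff.2 h0)]
      · rw [smul_smul, mul_inv_cancel₀ (norm_ne_zero_iff.2 h0), one_smul]
  · have h1 : (fun j => inner ℝ (φ j) (c • e)) = c • fun j => inner ℝ (φ j) e := by
      ext j; simp [inner_smul_right]
    have h2 : ∫ ω, f (fun j => X (φ j) ω) * X (c • e) ω ∂P =
        c * ∫ ω, f (fun j => X (φ j) ω) * X e ω ∂P := by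
      rw [← integral_const_mul]
      refine integral_congr_ae ?_
      filter_upwards [hX.map_smul c e] with ω hω
      rw [hω]; ring
    rw [h2, hX.integral_mul_of_norm_eq_one hf hC hC' φ he, h1, ← integral_const_mul]
    simp
  · have h1 := hX.map_smul 0 (0 : H)
    have h2 : (fun j => inner ℝ (φ j) (0 : H)) = (0 : Fin n → ℝ) := by ext; simp
    rw [h2, integral_congr_ae (g := fun _ => 0)]
    · simp
    · filter_upwards [h1] with ω hω
      simp only [zero_smul, zero_mul] at hω
      simp [hω]

end IsIsonormal

end Isonormal

/-! ### Smooth cutoff functions -/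

section Cutoff

/-- Dilates of one bump function. Dilating by `k + 1 ≥ 1` only shrinks the derivative, whence a
bound uniform in `k`. -/
theorem exists_cutoff_seq (E : Type*) [NormedAddCommGroup E] [NormedSpace ℝ E]
    [FiniteDimensional ℝ E] :
    ∃ (χ : ℕ → E → ℝ) (C : ℝ), (∀ k, ContDiff ℝ (⊤ : ℕ∞) (χ k)) ∧ (∀ k, HasCompactSupport (χ k)) ∧
      (∀ k x, ‖χ k x‖ ≤ 1) ∧ (∀ k x, ‖fderiv ℝ (χ k) x‖ ≤ C) ∧
      ∀ x, ∀ᶠ k in atTop, χ k =ᶠ[𝓝 x] fun _ => 1 := by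
  obtain ⟨b, hbs, hbc, hb1, hb⟩ : ∃ b : E → ℝ, ContDiff ℝ (⊤ : ℕ∞) b ∧ HasCompactSupport b ∧
      (∀ x, ‖b x‖ ≤ 1) ∧ ∀ x, ‖x‖ ≤ 1 → b x = 1 := by
    let b : ContDiffBump (0 : E) := ⟨1, 2, one_pos, one_lt_two⟩
    refine ⟨b, b.contDiff, b.hasCompactSupport, fun x => ?_, fun x hx => ?_⟩
    · rw [Real.norm_of_nonneg b.nonneg]; exact b.le_one
    · exact b.one_of_mem_closedBall (mem_closedBall_zero_iff.2 hx)
  have hc : ∀ k : ℕ, (0 : ℝ) < ((k : ℝ) + 1)⁻¹ := fun k => by positivity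
  obtain ⟨C, hC⟩ := (hbc.fderiv (𝕜 := ℝ)).exists_bound_of_continuous
    (hbs.continuous_fderiv (by simp))
  refine ⟨fun k x => b (((k : ℝ) + 1)⁻¹ • x), C, fun k => hbs.comp (contDiff_const_smul _),
    fun k => ?_, fun k x => hb1 _, fun k x => ?_, fun x => ?_⟩
  · exact hbc.comp_homeomorph (Homeomorph.smulOfNeZero _ (hc k).ne')
  · have h1 : HasFDerivAt (fun x : E => b (((k : ℝ) + 1)⁻¹ • x))
        ((fderiv ℝ b (((k : ℝ) + 1)⁻¹ • x)).comp
          (((k : ℝ) + 1)⁻¹ • ContinuousLinearMap.id ℝ E)) x := by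
      refine HasFDerivAt.comp x (hbs.differentiable (by simp) _).hasFDerivAt ?_
      exact (hasFDerivAt_id x).const_smul _
    rw [h1.fderiv, ContinuousLinearMap.comp_smul, ContinuousLinearMap.comp_id, norm_smul,
      Real.norm_of_nonneg (hc k).le]
    have h2 : ((k : ℝ) + 1)⁻¹ ≤ 1 := inv_le_one_of_one_le₀ (by simp)
    calc _ ≤ 1 * C := by gcongr; exact hC _
      _ = C := one_mul C
  · filter_upwards [eventually_ge_atTop ⌈‖x‖⌉₊] with k hk
    have hx : ‖x‖ < k + 1 := (Nat.ceil_le.1 hk).trans_lt (lt_add_one _)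
    filter_upwards [continuous_norm.continuousAt.eventually_lt_const hx] with y hy
    refine hb _ ?_
    rw [norm_smul, Real.norm_of_nonneg (hc k).le,
      inv_mul_le_iff₀ (by positivity)]
    simpa using hy.le

end Cutoff

/-! ### Calculus of cylindrical gradients -/

section Cylinder

variable {H : Type*} [NormedAddCommGroup H] [InnerProductSpace ℝ H]

/-- The gradient `∑ i, ∂ᵢf(x) φᵢ` of the cylindrical function `f` in the directions `φ`. -/
def cylGrad {n : ℕ} (f : (Fin n → ℝ) → ℝ) (φ : Fin n → H) (x : Fin n → ℝ) : H :=
  ∑ i, (fderiv ℝ f x (Pi.single i (1 : ℝ))) • φ i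

/-- Reduces the rules for gradients below to the rules for `fderiv`, by pairing with an arbitrary
`h`. -/
theorem inner_cylGrad {n : ℕ} (f : (Fin n → ℝ) → ℝ) (φ : Fin n → H) (x : Fin n → ℝ) (h : H) :
    inner ℝ (cylGrad f φ x) h = fderiv ℝ f x (fun i => inner ℝ (φ i) h) := by
  rw [cylGrad, sum_inner]
  conv_rhs => rw [← Finset.univ_sum_single (fun i => inner ℝ (φ i) h), map_sum]
  refine Finset.sum_congr rfl fun i _ => ?_
  rw [inner_smul_left]
  have : (Pi.single i (inner ℝ (φ i) h) : Fin n → ℝ) =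
      (inner ℝ (φ i) h) • Pi.single i (1 : ℝ) := by
    rw [← Pi.single_smul]; simp
  rw [this, _root_.map_smul]
  simp [mul_comm]

theorem norm_cylGrad_le {n : ℕ} (f : (Fin n → ℝ) → ℝ) (φ : Fin n → H) (x : Fin n → ℝ) :
    ‖cylGrad f φ x‖ ≤ (∑ i, ‖φ i‖) * ‖fderiv ℝ f x‖ := by
  rw [Finset.sum_mul]
  refine (norm_sum_le _ _).trans (Finset.sum_le_sum fun i _ => ?_)
  rw [norm_smul, mul_comm]
  gcongr
  refine ((fderiv ℝ f x).le_opNorm _).trans ?_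
  rw [Pi.norm_single, norm_one, mul_one]

theorem cylGrad_comp {m n : ℕ} {f : (Fin m → ℝ) → ℝ} (hf : Differentiable ℝ f)
    (σ : Fin m → Fin n) (φ : Fin n → H) (x : Fin n → ℝ) :
    cylGrad (fun x => f (x ∘ σ)) φ x = cylGrad f (φ ∘ σ) (x ∘ σ) := by
  refine ext_inner_right ℝ fun h => ?_
  rw [inner_cylGrad, inner_cylGrad]
  have h1 : HasFDerivAt (fun x : Fin n → ℝ => x ∘ σ)
      (ContinuousLinearMap.pi fun i => ContinuousLinearMap.proj (R := ℝ) (φ := fun _ : Fin n => ℝ)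
        (σ i)) x := by
    rw [hasFDerivAt_pi']
    intro i
    exact (ContinuousLinearMap.proj (R := ℝ) (φ := fun _ : Fin n => ℝ) (σ i)).hasFDerivAt
  have h2 : HasFDerivAt (fun x => f (x ∘ σ)) _ x := (hf _).hasFDerivAt.comp x h1
  rw [h2.fderiv]
  rfl

theorem cylGrad_add {n : ℕ} {f g : (Fin n → ℝ) → ℝ} (hf : Differentiable ℝ f)
    (hg : Differentiable ℝ g) (φ : Fin n → H) (x : Fin n → ℝ) :
    cylGrad (fun x => f x + g x) φ x = cylGrad f φ x + cylGrad g φ x := by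
  refine ext_inner_right ℝ fun h => ?_
  simp only [inner_add_left, inner_cylGrad]
  rw [fderiv_fun_add (hf x) (hg x)]
  rfl

theorem cylGrad_mul {n : ℕ} {f g : (Fin n → ℝ) → ℝ} (hf : Differentiable ℝ f)
    (hg : Differentiable ℝ g) (φ : Fin n → H) (x : Fin n → ℝ) :
    cylGrad (fun x => f x * g x) φ x = f x • cylGrad g φ x + g x • cylGrad f φ x := by
  refine ext_inner_right ℝ fun h => ?_
  simp only [inner_add_left, inner_smul_left, inner_cylGrad]
  rw [fderiv_fun_mul (hf x) (hg x)]
  rfl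

theorem cylGrad_scomp {n : ℕ} {f : (Fin n → ℝ) → ℝ} (hf : Differentiable ℝ f) {g : ℝ → ℝ}
    (hg : Differentiable ℝ g) (φ : Fin n → H) (x : Fin n → ℝ) :
    cylGrad (fun x => g (f x)) φ x = deriv g (f x) • cylGrad f φ x := by
  refine ext_inner_right ℝ fun h => ?_
  simp only [inner_smul_left, inner_cylGrad]
  have h2 : HasFDerivAt (fun x => g (f x)) _ x :=
    (hg (f x)).hasDerivAt.comp_hasFDerivAt x (hf x).hasFDerivAt
  rw [h2.fderiv]
  rfl

/-- Smooth functions which are bounded together with their first derivative. -/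
structure IsBddSmooth {n : ℕ} (f : (Fin n → ℝ) → ℝ) : Prop where
  contDiff : ContDiff ℝ (⊤ : ℕ∞) f
  bdd : ∃ C, ∀ x, ‖f x‖ ≤ C
  bdd_fderiv : ∃ C, ∀ x, ‖fderiv ℝ f x‖ ≤ C

namespace IsBddSmooth

variable {n : ℕ} {f g : (Fin n → ℝ) → ℝ}

theorem differentiable (hf : IsBddSmooth f) : Differentiable ℝ f :=
  hf.contDiff.differentiable (by simp)

theorem continuous_fderiv (hf : IsBddSmooth f) : Continuous (fderiv ℝ f) :=
  hf.contDiff.continuous_fderiv (by simp)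

theorem of_hasCompactSupport (hf : ContDiff ℝ (⊤ : ℕ∞) f) (hs : HasCompactSupport f) :
    IsBddSmooth f :=
  ⟨hf, hs.exists_bound_of_continuous hf.continuous,
    (hs.fderiv (𝕜 := ℝ)).exists_bound_of_continuous (hf.continuous_fderiv (by simp))⟩

theorem const (c : ℝ) : IsBddSmooth (fun _ : Fin n → ℝ => c) :=
  ⟨contDiff_const, ⟨‖c‖, fun _ => le_rfl⟩, ⟨0, fun x => by simp⟩⟩

theorem add (hf : IsBddSmooth f) (hg : IsBddSmooth g) : IsBddSmooth (fun x => f x + g x) := by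
  obtain ⟨C, hC⟩ := hf.bdd
  obtain ⟨D, hD⟩ := hg.bdd
  obtain ⟨C', hC'⟩ := hf.bdd_fderiv
  obtain ⟨D', hD'⟩ := hg.bdd_fderiv
  refine ⟨hf.contDiff.add hg.contDiff, ⟨C + D, fun x => norm_add_le_of_le (hC x) (hD x)⟩,
    C' + D', fun x => ?_⟩
  rw [fderiv_fun_add (hf.differentiable x) (hg.differentiable x)]
  exact norm_add_le_of_le (hC' x) (hD' x)

theorem mul (hf : IsBddSmooth f) (hg : IsBddSmooth g) : IsBddSmooth (fun x => f x * g x) := by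
  obtain ⟨C, hC⟩ := hf.bdd
  obtain ⟨D, hD⟩ := hg.bdd
  obtain ⟨C', hC'⟩ := hf.bdd_fderiv
  obtain ⟨D', hD'⟩ := hg.bdd_fderiv
  have hC0 : 0 ≤ C := (norm_nonneg _).trans (hC 0)
  have hD0 : 0 ≤ D := (norm_nonneg _).trans (hD 0)
  refine ⟨hf.contDiff.mul hg.contDiff, ⟨C * D, fun x => ?_⟩, C * D' + D * C', fun x => ?_⟩
  · rw [norm_mul]
    exact mul_le_mul (hC x) (hD x) (norm_nonneg _) hC0
  rw [fderiv_fun_mul (hf.differentiable x) (hg.differentiable x)]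
  refine norm_add_le_of_le ?_ ?_ <;> rw [norm_smul]
  · exact mul_le_mul (hC x) (hD' x) (norm_nonneg _) hC0
  · exact mul_le_mul (hD x) (hC' x) (norm_nonneg _) hD0

theorem comp_restrict {m : ℕ} (hf : IsBddSmooth f) (σ : Fin n → Fin m) :
    IsBddSmooth (fun x : Fin m → ℝ => f (x ∘ σ)) := by
  obtain ⟨C, hC⟩ := hf.bdd
  obtain ⟨C', hC'⟩ := hf.bdd_fderiv
  have h1 : ∀ x : Fin m → ℝ, HasFDerivAt (fun x : Fin m → ℝ => x ∘ σ)
      (ContinuousLinearMap.pi fun i => ContinuousLinearMap.proj (R := ℝ) (φ := fun _ : Fin m => ℝ)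
        (σ i)) x := by
    intro x
    rw [hasFDerivAt_pi']
    intro i
    exact (ContinuousLinearMap.proj (R := ℝ) (φ := fun _ : Fin m => ℝ) (σ i)).hasFDerivAt
  have hC0 : 0 ≤ C' := (norm_nonneg _).trans (hC' 0)
  refine ⟨hf.contDiff.comp (contDiff_pi.2 fun i => contDiff_apply ℝ ℝ (σ i)),
    ⟨C, fun x => hC _⟩, C', fun x => ?_⟩
  have h2 : HasFDerivAt (fun x => f (x ∘ σ)) _ x :=
    (hf.differentiable _).hasFDerivAt.comp x (h1 x)
  rw [h2.fderiv]
  refine ContinuousLinearMap.opNorm_le_bound _ hC0 fun v => ?_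
  refine ((fderiv ℝ f (x ∘ σ)).le_opNorm _).trans ?_
  gcongr
  · exact hC' _
  · rw [pi_norm_le_iff_of_nonneg (norm_nonneg _)]
    intro i
    exact norm_le_pi_norm v (σ i)

theorem scomp (hf : IsBddSmooth f) {u : ℝ → ℝ} (hu : ContDiff ℝ (⊤ : ℕ∞) u) {K : ℝ}
    (hK : ∀ x, ‖deriv u x‖ ≤ K) : IsBddSmooth (fun x => u (f x)) := by
  obtain ⟨C, hC⟩ := hf.bdd
  obtain ⟨C', hC'⟩ := hf.bdd_fderiv
  have hud : Differentiable ℝ u := hu.differentiable (by simp)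
  have hK0 : 0 ≤ K := (norm_nonneg _).trans (hK 0)
  refine ⟨hu.comp hf.contDiff, ?_, K * C', fun x => ?_⟩
  · obtain ⟨D, hD⟩ := (isCompact_Icc (a := -C) (b := C)).exists_bound_of_continuousOn
      hu.continuous.continuousOn
    exact ⟨D, fun x => hD _ (abs_le.1 (hC x))⟩
  · have h2 : HasFDerivAt (fun x => u (f x)) _ x :=
      (hud (f x)).hasDerivAt.comp_hasFDerivAt x (hf.differentiable x).hasFDerivAt
    rw [h2.fderiv, norm_smul]
    exact mul_le_mul (hK _) (hC' x) (norm_nonneg _) hK0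

end IsBddSmooth

end Cylinder

/-! ### The graph of the Malliavin derivative as a closed subspace -/

section Graph

variable {H : Type*} [NormedAddCommGroup H] [InnerProductSpace ℝ H]
variable {Ω : Type*} [MeasurableSpace Ω] {P : Measure Ω} {X : H → Ω → ℝ}

theorem IsIsonormal.aestronglyMeasurable_cylinder (hX : IsIsonormal X P) {E : Type*}
    [TopologicalSpace E] [TopologicalSpace.PseudoMetrizableSpace E] {n : ℕ} {f : (Fin n → ℝ) → E}
    (hf : Continuous f) (φ : Fin n → H) :
    AEStronglyMeasurable (fun ω => f (fun j => X (φ j) ω)) P :=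
  hf.stronglyMeasurable.aestronglyMeasurable.comp_aemeasurable (hX.aemeasurable_pi φ)

theorem continuous_cylGrad {n : ℕ} {f : (Fin n → ℝ) → ℝ} (hf : Continuous (fderiv ℝ f))
    (φ : Fin n → H) : Continuous (cylGrad f φ) := by
  unfold cylGrad; fun_prop

theorem IsBddSmooth.memLp (hX : IsIsonormal X P) {n : ℕ} {f : (Fin n → ℝ) → ℝ}
    (hf : IsBddSmooth f) (φ : Fin n → H) (p : ℝ≥0∞) :
    MemLp (fun ω => f (fun j => X (φ j) ω)) p P := by
  have := hX.isProbabilityMeasure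
  obtain ⟨C, hC⟩ := hf.bdd
  exact MemLp.of_bound (hX.aestronglyMeasurable_cylinder hf.contDiff.continuous φ) C
    (ae_of_all _ fun ω => hC _)

theorem IsBddSmooth.memLp_cylGrad (hX : IsIsonormal X P) {n : ℕ} {f : (Fin n → ℝ) → ℝ}
    (hf : IsBddSmooth f) (φ : Fin n → H) (p : ℝ≥0∞) :
    MemLp (fun ω => cylGrad f φ (fun j => X (φ j) ω)) p P := by
  have := hX.isProbabilityMeasure
  obtain ⟨C, hC⟩ := hf.bdd_fderiv
  exact MemLp.of_bound (hX.aestronglyMeasurable_cylinder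
    (continuous_cylGrad hf.continuous_fderiv φ) φ) ((∑ i, ‖φ i‖) * C)
    (ae_of_all _ fun ω => (norm_cylGrad_le _ _ _).trans (by gcongr; exact hC _))

/-- A smooth cylindrical variable which is square integrable together with its derivative belongs
to the domain of the Malliavin derivative. -/
theorem mem_malliavinGraph_of_memLp (hX : IsIsonormal X P) {n : ℕ} (hn : 1 ≤ n)
    {f : (Fin n → ℝ) → ℝ} (hf : ContDiff ℝ (⊤ : ℕ∞) f) (φ : Fin n → H)
    (hF : MemLp (fun ω => f (fun j => X (φ j) ω)) 2 P)
    (hF' : MemLp (fun ω => ‖fderiv ℝ f (fun j => X (φ j) ω)‖) 2 P)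
    {p : Lp ℝ 2 P × Lp H 2 P} (hp1 : p.1 =ᵐ[P] fun ω => f (fun j => X (φ j) ω))
    (hp2 : p.2 =ᵐ[P] fun ω => cylGrad f φ (fun j => X (φ j) ω)) :
    p ∈ malliavinGraph X P := by
  -- Approximate by `χ k * f`: the gradients are dominated by `(∑ i, ‖φ i‖) * (‖f'‖ + C * |f|)`,
  -- which is square integrable.
  obtain ⟨χ, C, hχs, hχc, hχ1, hχC, hχlim⟩ := exists_cutoff_seq (Fin n → ℝ)
  have hfd : Differentiable ℝ f := hf.differentiable (by simp)
  have hχd : ∀ k, Differentiable ℝ (χ k) := fun k => (hχs k).differentiable (by simp)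
  have hgs : ∀ k, ContDiff ℝ (⊤ : ℕ∞) (fun x => χ k x * f x) := fun k => (hχs k).mul hf
  have hgc : ∀ k, HasCompactSupport (fun x => χ k x * f x) := fun k => (hχc k).mul_right
  have hgb : ∀ k, IsBddSmooth (fun x => χ k x * f x) := fun k =>
    .of_hasCompactSupport (hgs k) (hgc k)
  have hU : MemLp (fun ω => cylGrad f φ (fun j => X (φ j) ω)) 2 P :=
    (memLp_congr_ae hp2).1 (Lp.memLp _)
  have e1 : p.1 = hF.toLp _ := Lp.ext (hp1.trans hF.coeFn_toLp.symm)
  have e2 : p.2 = hU.toLp _ := Lp.ext (hp2.trans hU.coeFn_toLp.symm)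
  have t1 := tendsto_toLp_two_of_dominated (fun k => (hgb k).memLp hX φ 2) hF hF.norm
    (fun k => ae_of_all _ fun ω => by
      rw [norm_mul]
      exact mul_le_of_le_one_left (norm_nonneg _) (hχ1 _ _))
    (ae_of_all _ fun ω => by
      refine tendsto_const_nhds.congr' ?_
      filter_upwards [hχlim fun j => X (φ j) ω] with k hk
      rw [hk.self_of_nhds, one_mul])
  have t2 := tendsto_toLp_two_of_dominated (fun k => (hgb k).memLp_cylGrad hX φ 2) hU
    ((hF'.add (hF.norm.const_mul C)).const_mul (∑ i, ‖φ i‖))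
    (fun k => ae_of_all _ fun ω => by
      refine (norm_cylGrad_le _ _ _).trans ?_
      refine mul_le_mul_of_nonneg_left ?_ (by positivity)
      rw [fderiv_fun_mul (hχd k _) (hfd _)]
      refine norm_add_le_of_le ?_ ?_ <;> rw [norm_smul]
      · exact mul_le_of_le_one_left (norm_nonneg _) (hχ1 _ _)
      · rw [mul_comm]
        exact mul_le_mul_of_nonneg_right (hχC _ _) (norm_nonneg _))
    (ae_of_all _ fun ω => by
      refine tendsto_const_nhds.congr' ?_
      filter_upwards [hχlim fun j => X (φ j) ω] with k hk
      have : (fun x => χ k x * f x) =ᶠ[𝓝 fun j => X (φ j) ω] f := by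
        filter_upwards [hk] with x hx
        rw [hx, one_mul]
      simp only [cylGrad, this.fderiv_eq])
  refine mem_closure_of_tendsto (b := atTop) (f := fun k => (((hgb k).memLp hX φ 2).toLp _,
    ((hgb k).memLp_cylGrad hX φ 2).toLp _)) ?_ (Eventually.of_forall fun k => ?_)
  · rw [show p = (p.1, p.2) from rfl, e1, e2]
    exact t1.prodMk_nhds t2
  · exact ⟨n, _, φ, hn, hgs k, hgc k, ((hgb k).memLp hX φ 2).coeFn_toLp,
      ((hgb k).memLp_cylGrad hX φ 2).coeFn_toLp⟩

/-- `F` and `U` are a bounded smooth cylindrical variable and its derivative. -/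
def IsBddCylinder (X : H → Ω → ℝ) (F : Ω → ℝ) (U : Ω → H) : Prop :=
  ∃ (n : ℕ) (f : (Fin n → ℝ) → ℝ) (φ : Fin n → H), 1 ≤ n ∧ IsBddSmooth f ∧
    (F = fun ω => f (fun j => X (φ j) ω)) ∧ U = fun ω => cylGrad f φ (fun j => X (φ j) ω)

namespace IsBddCylinder

variable {F G : Ω → ℝ} {U V : Ω → H}

omit [MeasurableSpace Ω] in
-- Concatenating the directions lets two cylinders share them. The pullback of a compactly supported
-- function along a coordinate projection need not have compact support, which is why boundedness is
-- the working condition.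
theorem exists_common (hF : IsBddCylinder X F U) (hG : IsBddCylinder X G V) :
    ∃ (n : ℕ) (f g : (Fin n → ℝ) → ℝ) (φ : Fin n → H), 1 ≤ n ∧ IsBddSmooth f ∧ IsBddSmooth g ∧
    (F = fun ω => f (fun j => X (φ j) ω)) ∧ (U = fun ω => cylGrad f φ (fun j => X (φ j) ω)) ∧
    (G = fun ω => g (fun j => X (φ j) ω)) ∧ V = fun ω => cylGrad g φ (fun j => X (φ j) ω) := by
  obtain ⟨m, f, φ, hm, hf, rfl, rfl⟩ := hF
  obtain ⟨n, g, ψ, hn, hg, rfl, rfl⟩ := hG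
  have h1 : Fin.append φ ψ ∘ Fin.castAdd n = φ := by ext i; simp
  have h2 : Fin.append φ ψ ∘ Fin.natAdd m = ψ := by ext i; simp
  refine ⟨m + n, fun x => f (x ∘ Fin.castAdd n), fun x => g (x ∘ Fin.natAdd m), Fin.append φ ψ,
    by omega, hf.comp_restrict _, hg.comp_restrict _, ?_, ?_, ?_, ?_⟩
  · ext ω; simp [Function.comp_def]
  · ext ω; rw [cylGrad_comp hf.differentiable, h1]; simp [Function.comp_def]
  · ext ω; simp [Function.comp_def]
  · ext ω; rw [cylGrad_comp hg.differentiable, h2]; simp [Function.comp_def]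

omit [MeasurableSpace Ω] in
theorem const (X : H → Ω → ℝ) (c : ℝ) : IsBddCylinder X (fun _ => c) 0 :=
  ⟨1, fun _ => c, 0, le_rfl, .const c, rfl, by ext ω; simp [cylGrad]⟩

omit [MeasurableSpace Ω] in
theorem add (hF : IsBddCylinder X F U) (hG : IsBddCylinder X G V) :
    IsBddCylinder X (fun ω => F ω + G ω) (fun ω => U ω + V ω) := by
  obtain ⟨n, f, g, φ, hn, hf, hg, rfl, rfl, rfl, rfl⟩ := hF.exists_common hG
  exact ⟨n, _, φ, hn, hf.add hg, rfl, by
    ext ω; rw [cylGrad_add hf.differentiable hg.differentiable]⟩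

omit [MeasurableSpace Ω] in
theorem mul (hF : IsBddCylinder X F U) (hG : IsBddCylinder X G V) :
    IsBddCylinder X (fun ω => F ω * G ω) (fun ω => F ω • V ω + G ω • U ω) := by
  obtain ⟨n, f, g, φ, hn, hf, hg, rfl, rfl, rfl, rfl⟩ := hF.exists_common hG
  exact ⟨n, _, φ, hn, hf.mul hg, rfl, by
    ext ω; rw [cylGrad_mul hf.differentiable hg.differentiable]⟩

omit [MeasurableSpace Ω] in
theorem scomp (hF : IsBddCylinder X F U) {u : ℝ → ℝ} (hu : ContDiff ℝ (⊤ : ℕ∞) u) {K : ℝ}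
    (hK : ∀ x, ‖deriv u x‖ ≤ K) :
    IsBddCylinder X (fun ω => u (F ω)) (fun ω => deriv u (F ω) • U ω) := by
  obtain ⟨n, f, φ, hn, hf, rfl, rfl⟩ := hF
  exact ⟨n, _, φ, hn, hf.scomp hu hK, rfl, by
    ext ω; rw [cylGrad_scomp hf.differentiable (hu.differentiable (by simp))]⟩

theorem memLp_fst (hX : IsIsonormal X P) (hF : IsBddCylinder X F U) (p : ℝ≥0∞) : MemLp F p P := by
  obtain ⟨n, f, φ, hn, hf, rfl, rfl⟩ := hF
  exact hf.memLp hX φ p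

theorem memLp_snd (hX : IsIsonormal X P) (hF : IsBddCylinder X F U) (p : ℝ≥0∞) : MemLp U p P := by
  obtain ⟨n, f, φ, hn, hf, rfl, rfl⟩ := hF
  exact hf.memLp_cylGrad hX φ p

omit [MeasurableSpace Ω] in
theorem exists_bound (hF : IsBddCylinder X F U) : ∃ C, ∀ ω, ‖F ω‖ ≤ C := by
  obtain ⟨n, f, φ, hn, hf, rfl, rfl⟩ := hF
  exact hf.bdd.imp fun C hC ω => hC _

omit [MeasurableSpace Ω] in
theorem exists_bound_snd (hF : IsBddCylinder X F U) : ∃ C, ∀ ω, ‖U ω‖ ≤ C := by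
  obtain ⟨n, f, φ, hn, hf, rfl, rfl⟩ := hF
  obtain ⟨C, hC⟩ := hf.bdd_fderiv
  exact ⟨_, fun ω => (norm_cylGrad_le _ _ _).trans
    (mul_le_mul_of_nonneg_left (hC _) (by positivity))⟩

theorem mem_malliavinGraph (hX : IsIsonormal X P) (hF : IsBddCylinder X F U)
    {p : Lp ℝ 2 P × Lp H 2 P} (hp1 : p.1 =ᵐ[P] F) (hp2 : p.2 =ᵐ[P] U) :
    p ∈ malliavinGraph X P := by
  have := hX.isProbabilityMeasure
  obtain ⟨n, f, φ, hn, hf, rfl, rfl⟩ := hF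
  refine mem_malliavinGraph_of_memLp hX hn hf.contDiff φ (hf.memLp hX φ 2) ?_ hp1 hp2
  obtain ⟨C, hC⟩ := hf.bdd_fderiv
  exact MemLp.of_bound (hX.aestronglyMeasurable_cylinder hf.continuous_fderiv.norm φ) C
    (ae_of_all _ fun ω => by rw [norm_norm]; exact hC _)

/-- Gaussian integration by parts: `E(F X(h)) = E⟪DF, h⟫`. -/
theorem integral_mul_eq (hX : IsIsonormal X P) (hF : IsBddCylinder X F U) (h : H) :
    ∫ ω, F ω * X h ω ∂P = ∫ ω, inner ℝ (U ω) h ∂P := by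
  obtain ⟨n, f, φ, hn, hf, rfl, rfl⟩ := hF
  obtain ⟨C, hC⟩ := hf.bdd
  obtain ⟨C', hC'⟩ := hf.bdd_fderiv
  simp only [inner_cylGrad]
  exact hX.integral_mul_eq (hf.contDiff.of_le (by simp)) hC hC' φ h

end IsBddCylinder

/-- Bounded smooth cylindrical variables, with their derivatives. -/
def bddPairs (X : H → Ω → ℝ) (P : Measure Ω) : Submodule ℝ (Lp ℝ 2 P × Lp H 2 P) where
  carrier := {p | ∃ F U, IsBddCylinder X F U ∧ p.1 =ᵐ[P] F ∧ p.2 =ᵐ[P] U}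
  zero_mem' := ⟨_, _, .const X 0, Lp.coeFn_zero _ _ _, Lp.coeFn_zero _ _ _⟩
  add_mem' := by
    rintro p q ⟨F, U, h, h1, h2⟩ ⟨G, V, h', h1', h2'⟩
    exact ⟨_, _, h.add h', (Lp.coeFn_add _ _).trans (h1.add h1'),
      (Lp.coeFn_add _ _).trans (h2.add h2')⟩
  smul_mem' := by
    rintro c p ⟨F, U, h, h1, h2⟩
    refine ⟨_, _, (IsBddCylinder.const X c).mul h, (Lp.coeFn_smul _ _).trans ?_,
      (Lp.coeFn_smul _ _).trans ?_⟩
    · filter_upwards [h1] with ω h; simp [h]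
    · filter_upwards [h2] with ω h; simp [h]

theorem smoothPairs_subset_bddPairs : smoothPairs X P ⊆ bddPairs X P := by
  rintro p ⟨n, f, φ, hn, hf, hfc, h1, h2⟩
  exact ⟨_, _, ⟨n, f, φ, hn, .of_hasCompactSupport hf hfc, rfl, rfl⟩, h1, h2⟩

/-- The graph of the Malliavin derivative as a linear subspace. -/
def graphSubmodule (X : H → Ω → ℝ) (P : Measure Ω) : Submodule ℝ (Lp ℝ 2 P × Lp H 2 P) :=
  (bddPairs X P).topologicalClosure

/-- Bounded cylinders are limits of compactly supported ones, so the two closures agree; the bounded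
ones visibly form a linear space. -/
theorem coe_graphSubmodule (hX : IsIsonormal X P) :
    (graphSubmodule X P : Set (Lp ℝ 2 P × Lp H 2 P)) = malliavinGraph X P := by
  refine Subset.antisymm ?_ (closure_mono smoothPairs_subset_bddPairs)
  refine closure_minimal ?_ isClosed_closure
  rintro p ⟨F, U, h, h1, h2⟩
  exact h.mem_malliavinGraph hX h1 h2

theorem mem_graphSubmodule_iff (hX : IsIsonormal X P) {p : Lp ℝ 2 P × Lp H 2 P} :
    p ∈ graphSubmodule X P ↔ p ∈ malliavinGraph X P := by
  rw [← coe_graphSubmodule hX]; rfl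

end Graph

/-! ### Closed operators and orthogonal projections in Hilbert space -/

section HilbertSpace

variable {E E' : Type*} [NormedAddCommGroup E] [InnerProductSpace ℝ E] [CompleteSpace E]
  [NormedAddCommGroup E'] [InnerProductSpace ℝ E'] [CompleteSpace E']

/-- If `Γ` is the graph of a closed operator `D`, the eigenspace of `D* D` for the eigenvalue
`c`. -/
def adjointEigenspace (Γ : Submodule ℝ (E × E')) (c : ℝ) : Submodule ℝ E where
  carrier := {F | ∃ U, (F, U) ∈ Γ ∧ ∀ q ∈ Γ, inner ℝ U q.2 = c * inner ℝ F q.1}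
  zero_mem' := ⟨0, Γ.zero_mem, fun q _ => by simp⟩
  add_mem' := by
    rintro F G ⟨U, hU, h⟩ ⟨V, hV, h'⟩
    refine ⟨U + V, Γ.add_mem hU hV, fun q hq => ?_⟩
    rw [inner_add_left, inner_add_left, h q hq, h' q hq]; ring
  smul_mem' := by
    rintro a F ⟨U, hU, h⟩
    refine ⟨a • U, Γ.smul_mem a hU, fun q hq => ?_⟩
    rw [inner_smul_left, inner_smul_left, h q hq]; simp; ring

omit [CompleteSpace E] in
theorem isClosed_adjointEigenspace {Γ : Submodule ℝ (E × E')} (hΓ : IsClosed (Γ : Set (E × E')))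
    {c : ℝ} (hc : 0 ≤ c) : IsClosed (adjointEigenspace Γ c : Set E) := by
  refine isClosed_of_closure_subset fun F hF => ?_
  obtain ⟨f, hf, hlim⟩ := mem_closure_iff_seq_limit.1 hF
  choose U hU h using hf
  -- Testing the eigenvalue relation on the difference itself gives `‖U‖² = c ‖F‖²`, so convergence
  -- of eigenvectors forces convergence of their derivatives.
  have hdist : ∀ m n, dist (U m) (U n) = √c * dist (f m) (f n) := fun m n => by
    have h0 := Γ.sub_mem (hU m) (hU n)
    have h1 : inner ℝ (U m - U n) (U m - U n) = c * inner ℝ (f m - f n) (f m - f n) := by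
      have e1 : inner ℝ (U m) (U m - U n) = c * inner ℝ (f m) (f m - f n) := h m _ h0
      have e2 : inner ℝ (U n) (U m - U n) = c * inner ℝ (f n) (f m - f n) := h n _ h0
      rw [inner_sub_left, e1, e2, inner_sub_left (f m) (f n)]; ring
    rw [real_inner_self_eq_norm_sq, real_inner_self_eq_norm_sq] at h1
    rw [dist_eq_norm, dist_eq_norm, ← Real.sqrt_sq (norm_nonneg (U m - U n)), h1,
      Real.sqrt_mul hc, Real.sqrt_sq (norm_nonneg _)]
  have hcau : CauchySeq U := by
    rw [Metric.cauchySeq_iff]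
    intro ε hε
    obtain ⟨N, hN⟩ := Metric.cauchySeq_iff.1 hlim.cauchySeq (ε / (√c + 1)) (by positivity)
    refine ⟨N, fun m hm n hn => ?_⟩
    rw [hdist]
    have h1 := hN m hm n hn
    rw [lt_div_iff₀ (by positivity)] at h1
    nlinarith [dist_nonneg (x := f m) (y := f n), Real.sqrt_nonneg c]
  obtain ⟨V, hV⟩ := cauchySeq_tendsto_of_complete hcau
  refine ⟨V, hΓ.mem_of_tendsto (hlim.prodMk_nhds hV) (Eventually.of_forall hU), fun q hq => ?_⟩
  exact tendsto_nhds_unique (hV.inner tendsto_const_nhds)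
    (((hlim.inner tendsto_const_nhds).const_mul c).congr fun n => (h n q hq).symm)

omit [CompleteSpace E] [CompleteSpace E'] in
-- Symmetry of `D* D`: `⟪U, V⟫` equals both `c * ⟪F, G⟫` and `d * ⟪F, G⟫`.
theorem inner_eq_zero_of_mem_adjointEigenspace {Γ : Submodule ℝ (E × E')} {c d : ℝ} (hcd : c ≠ d)
    {F G : E} (hF : F ∈ adjointEigenspace Γ c) (hG : G ∈ adjointEigenspace Γ d) :
    inner ℝ F G = 0 := by
  obtain ⟨U, hU, h⟩ := hF
  obtain ⟨V, hV, h'⟩ := hG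
  have h1 := h _ hV
  have h2 := h' _ hU
  simp only at h1 h2
  rw [real_inner_comm, h1, real_inner_comm] at h2
  have : (c - d) * inner ℝ G F = 0 := by linarith
  rw [real_inner_comm]
  exact (mul_eq_zero.1 this).resolve_left (sub_ne_zero.2 hcd)

/-- The inverse of `D* D` on a sum of eigenvectors. -/
theorem exists_adjoint_inverse {Γ : Submodule ℝ (E × E')} (hΓ : IsClosed (Γ : Set (E × E')))
    {F : ℕ → E} (hF : ∀ m : ℕ, F m ∈ adjointEigenspace Γ ((m : ℝ) + 1)) (hs : Summable F)
    (hs' : Summable fun m : ℕ => (1 / ((m : ℝ) + 1)) • F m) :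
    ∃ V, (∑' m : ℕ, (1 / ((m : ℝ) + 1)) • F m, V) ∈ Γ ∧
      ∀ q ∈ Γ, inner ℝ V q.2 = inner ℝ (∑' m, F m) q.1 := by
  classical
  choose U hU h using hF
  set W : ℕ → E := fun m => (1 / ((m : ℝ) + 1)) • F m with hW
  set Y : ℕ → E' := fun m => (1 / ((m : ℝ) + 1)) • U m with hY
  have hΓm : ∀ m, (W m, Y m) ∈ Γ := fun m => Γ.smul_mem _ (hU m)
  have hin : ∀ m, ∀ q ∈ Γ, inner ℝ (Y m) q.2 = inner ℝ (F m) q.1 := fun m q hq => by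
    simp only [hY]
    rw [real_inner_smul_left, h m q hq, ← mul_assoc, one_div_mul_cancel (by positivity), one_mul]
  have hΓs : ∀ s : Finset ℕ, (∑ m ∈ s, W m, ∑ m ∈ s, Y m) ∈ Γ := fun s => by
    have := Γ.sum_mem (t := s) fun m _ => hΓm m
    rwa [show ∑ m ∈ s, (W m, Y m) = (∑ m ∈ s, W m, ∑ m ∈ s, Y m) from
      Prod.ext (by simp [Prod.fst_sum]) (by simp [Prod.snd_sum])] at this
  -- Testing on the partial sum itself gives `‖∑ Y‖² = ⟪∑ F, ∑ W⟫`, so the Cauchy criterion for `F`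
  -- and `W` passes to `Y`.
  have hnorm : ∀ s : Finset ℕ,
      ‖∑ m ∈ s, Y m‖ ^ 2 ≤ ‖∑ m ∈ s, F m‖ * ‖∑ m ∈ s, W m‖ := fun s => by
    rw [← real_inner_self_eq_norm_sq]
    refine le_trans (le_of_eq ?_) (real_inner_le_norm _ _)
    rw [sum_inner, sum_inner]
    exact Finset.sum_congr rfl fun m _ => hin m _ (hΓs s)
  have hYs : Summable Y := by
    rw [summable_iff_vanishing_norm] at hs hs' ⊢
    intro ε hε
    obtain ⟨s₁, h₁⟩ := hs ε hε
    obtain ⟨s₂, h₂⟩ := hs' ε hε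
    refine ⟨s₁ ∪ s₂, fun t ht => ?_⟩
    have a := h₁ t (ht.mono_right Finset.subset_union_left)
    have b := h₂ t (ht.mono_right Finset.subset_union_right)
    refine lt_of_pow_lt_pow_left₀ 2 hε.le ((hnorm t).trans_lt ?_)
    rw [sq]
    exact mul_lt_mul'' a b (norm_nonneg _) (norm_nonneg _)
  refine ⟨∑' m, Y m, ?_, fun q hq => ?_⟩
  · exact hΓ.mem_of_tendsto (hs'.hasSum.prodMk_nhds hYs.hasSum) (Eventually.of_forall hΓs)
  · have a := hYs.hasSum.mapL ((innerSL ℝ).flip q.2)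
    have b := hs.hasSum.mapL ((innerSL ℝ).flip q.1)
    refine a.unique (b.congr_fun ?_)
    intro m
    exact hin m q hq

section Projections

variable {K : ℕ → Submodule ℝ E} [∀ m, CompleteSpace (K m)]

omit [CompleteSpace E] in
theorem inner_starProjection_right_of_mem {L : Submodule ℝ E} [L.HasOrthogonalProjection] (x : E)
    {k : E} (hk : k ∈ L) : inner ℝ (L.starProjection x) k = inner ℝ x k := by
  rw [Submodule.inner_starProjection_left_eq_right, Submodule.starProjection_eq_self_iff.2 hk]

/-- Bessel's inequality, read off from `0 ≤ ‖x - ∑ m ∈ s, (K m).starProjection x‖ ^ 2`. -/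
theorem summable_smul_starProjection
    (hK : ∀ m n, m ≠ n → ∀ x ∈ K m, ∀ y ∈ K n, inner ℝ x y = 0) {c : ℕ → ℝ}
    (hc : ∀ m, ‖c m‖ ≤ 1) (x : E) : Summable fun m => c m • (K m).starProjection x := by
  have hV : OrthogonalFamily ℝ (fun m => K m) fun m => (K m).subtypeₗᵢ :=
    fun m n hmn a b => hK m n hmn a a.2 b b.2
  have h1 := hV.summable_iff_norm_sq_summable
    fun m => (⟨c m • (K m).starProjection x, (K m).smul_mem _ (by simp)⟩ : K m)
  refine h1.2 ?_
  refine summable_of_sum_le (c := ‖x‖ ^ 2) (fun _ => by positivity) fun s => ?_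
  have h2 : ∑ m ∈ s, ‖(K m).starProjection x‖ ^ 2 ≤ ‖x‖ ^ 2 := by
    have h3 : ∀ m, inner ℝ x ((K m).starProjection x) = ‖(K m).starProjection x‖ ^ 2 := fun m => by
      rw [← real_inner_self_eq_norm_sq, inner_starProjection_right_of_mem x (by simp)]
    have h4 : ‖∑ m ∈ s, (K m).starProjection x‖ ^ 2 = ∑ m ∈ s, ‖(K m).starProjection x‖ ^ 2 :=
      hV.norm_sum (fun m => ⟨(K m).starProjection x, by simp⟩) s
    have h5 := norm_sub_sq_real x (∑ m ∈ s, (K m).starProjection x)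
    rw [inner_sum, h4, Finset.sum_congr rfl fun m _ => h3 m] at h5
    nlinarith [sq_nonneg ‖x - ∑ m ∈ s, (K m).starProjection x‖]
  refine (Finset.sum_le_sum fun m _ => ?_).trans h2
  have : ‖c m • (K m).starProjection x‖ ≤ ‖(K m).starProjection x‖ := by
    rw [norm_smul]
    exact mul_le_of_le_one_left (norm_nonneg _) (hc m)
  simpa using pow_le_pow_left₀ (norm_nonneg _) this 2

theorem inner_tsum_starProjection
    (hK : ∀ m n, m ≠ n → ∀ x ∈ K m, ∀ y ∈ K n, inner ℝ x y = 0) (x : E) {n : ℕ} {k : E}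
    (hk : k ∈ K n) : inner ℝ (∑' m, (K m).starProjection x) k = inner ℝ x k := by
  have hs : Summable fun m => (K m).starProjection x := by
    simpa using summable_smul_starProjection hK (c := fun _ => 1) (by simp) x
  have a := hs.hasSum.mapL ((innerSL ℝ).flip k)
  refine (a.unique (hasSum_single n fun m hm => ?_)).trans
    (inner_starProjection_right_of_mem x hk)
  exact hK m n hm _ (by simp) _ hk

omit [CompleteSpace E] in
theorem inner_tsum_starProjection_eq_zero (x : E) {k : E}
    (hk : ∀ m, ∀ y ∈ K m, inner ℝ y k = 0) : inner ℝ (∑' m, (K m).starProjection x) k = 0 := by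
  by_cases hs : Summable fun m => (K m).starProjection x
  · have a := hs.hasSum.mapL ((innerSL ℝ).flip k)
    refine a.unique ?_
    convert! hasSum_zero using 1
    ext m
    exact hk m _ (by simp)
  · rw [tsum_eq_zero_of_not_summable hs, inner_zero_left]

end Projections

end HilbertSpace

/-! ### Divergence and closability of the derivative -/

section Duality

variable {H : Type*} [NormedAddCommGroup H] [InnerProductSpace ℝ H]
variable {Ω : Type*} [MeasurableSpace Ω] {P : Measure Ω} {X : H → Ω → ℝ}

namespace IsBddCylinder

variable {G : Ω → ℝ} {V : Ω → H}

theorem memLp_smul_const (hX : IsIsonormal X P) (hG : IsBddCylinder X G V) (h : H) :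
    MemLp (fun ω => G ω • h) 2 P := by
  have := hX.isProbabilityMeasure
  obtain ⟨C, hC⟩ := hG.exists_bound
  refine MemLp.of_bound ((hG.memLp_fst hX 2).aestronglyMeasurable.smul_const h) (C * ‖h‖)
    (ae_of_all _ fun ω => ?_)
  rw [norm_smul]
  gcongr
  exact hC ω

/-- The variable is the divergence `D*(G h)`. -/
theorem memLp_mul_sub_inner (hX : IsIsonormal X P) (hG : IsBddCylinder X G V) (h : H) :
    MemLp (fun ω => G ω * X h ω - inner ℝ (V ω) h) 2 P := by
  have := hX.isProbabilityMeasure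
  obtain ⟨C, hC⟩ := hG.exists_bound
  obtain ⟨C', hC'⟩ := hG.exists_bound_snd
  refine MemLp.sub ?_ ?_
  · refine ((hX.memLp h (p := 2) (by simp)).norm.const_mul C).mono
      ((hG.memLp_fst hX 2).aestronglyMeasurable.mul (hX.aemeasurable h).aestronglyMeasurable)
      (ae_of_all _ fun ω => ?_)
    rw [norm_mul]
    refine le_trans ?_ (le_abs_self _)
    gcongr
    exact hC ω
  · refine MemLp.of_bound ((hG.memLp_snd hX 2).aestronglyMeasurable.inner
      aestronglyMeasurable_const) (C' * ‖h‖) (ae_of_all _ fun ω => ?_)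
    refine (norm_inner_le_norm _ _).trans ?_
    gcongr
    exact hC' ω

/-- Duality between the Malliavin derivative and the divergence of `G h`. -/
theorem inner_smul_const (hX : IsIsonormal X P) (hG : IsBddCylinder X G V) (h : H)
    {p : Lp ℝ 2 P × Lp H 2 P} (hp : p ∈ graphSubmodule X P) :
    inner ℝ p.2 ((hG.memLp_smul_const hX h).toLp _) =
      inner ℝ p.1 ((hG.memLp_mul_sub_inner hX h).toLp _) := by
  have hcl : IsClosed {p : Lp ℝ 2 P × Lp H 2 P |
      inner ℝ p.2 ((hG.memLp_smul_const hX h).toLp _) =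
      inner ℝ p.1 ((hG.memLp_mul_sub_inner hX h).toLp _)} :=
    isClosed_eq (by fun_prop) (by fun_prop)
  refine closure_minimal ?_ hcl hp
  rintro p ⟨F, U, hF, h1, h2⟩
  simp only [mem_ofPred_eq]
  rw [L2.inner_def, L2.inner_def]
  -- Integration by parts for the product, with `D(F G) = F V + G U`.
  have hmul := (hF.mul hG).integral_mul_eq hX h
  have e1 : ∫ ω, inner ℝ (p.2 ω) ((hG.memLp_smul_const hX h).toLp _ ω) ∂P =
      ∫ ω, G ω * inner ℝ (U ω) h ∂P := by
    refine integral_congr_ae ?_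
    filter_upwards [h2, (hG.memLp_smul_const hX h).coeFn_toLp] with ω a b
    rw [a, b, inner_smul_right]
  have e2 : ∫ ω, inner ℝ (p.1 ω) ((hG.memLp_mul_sub_inner hX h).toLp _ ω) ∂P =
      ∫ ω, (F ω * G ω * X h ω - F ω * inner ℝ (V ω) h) ∂P := by
    refine integral_congr_ae ?_
    filter_upwards [h1, (hG.memLp_mul_sub_inner hX h).coeFn_toLp] with ω a b
    rw [a, b]; simp; ring
  have i1 : Integrable (fun ω => F ω * inner ℝ (V ω) h) P := by
    have := ((hF.memLp_fst hX 2).integrable_mul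
      ((hG.memLp_snd hX 2).inner_const h))
    exact this
  have i2 : Integrable (fun ω => G ω * inner ℝ (U ω) h) P := by
    have := ((hG.memLp_fst hX 2).integrable_mul
      ((hF.memLp_snd hX 2).inner_const h))
    exact this
  have i3 : Integrable (fun ω => F ω * G ω * X h ω) P :=
    ((hF.mul hG).memLp_fst hX 2).integrable_mul (hX.memLp h (p := 2) (by simp))
  rw [e1, e2, integral_sub i3 i1, hmul]
  simp only [inner_add_left, inner_smul_left, conj_trivial]
  rw [integral_add i1 i2]; ring

end IsBddCylinder

/-- The Malliavin derivative is closable. -/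
theorem eq_zero_of_mem_graphSubmodule (hX : IsIsonormal X P) {V : Lp H 2 P}
    (hV : ((0 : Lp ℝ 2 P), V) ∈ graphSubmodule X P) : V = 0 := by
  have hcl : IsClosed {q : Lp ℝ 2 P × Lp H 2 P | inner ℝ V q.2 = 0} :=
    isClosed_eq (by fun_prop) continuous_const
  -- By duality `V` is orthogonal to every `DF = ∑ i, ∂ᵢf φᵢ`, hence to their limit `V`. Compactly
  -- supported `f` are used so that the `∂ᵢf` are again bounded cylinders.
  have hV' : ((0 : Lp ℝ 2 P), V) ∈ closure (smoothPairs X P) :=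
    (mem_graphSubmodule_iff hX).1 hV
  refine inner_self_eq_zero (𝕜 := ℝ).1 (closure_minimal ?_ hcl hV')
  rintro q ⟨n, f, φ, hn, hf, hfc, -, h2⟩
  have hG : ∀ i, IsBddCylinder X
      (fun ω => fderiv ℝ f (fun j => X (φ j) ω) (Pi.single i (1 : ℝ))) _ := fun i =>
    ⟨n, fun x => fderiv ℝ f x (Pi.single i 1), φ, hn, .of_hasCompactSupport
      ((hf.fderiv_right (m := (⊤ : ℕ∞)) (by simp)).clm_apply contDiff_const)
      (hfc.fderiv_apply (𝕜 := ℝ) _), rfl, rfl⟩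
  have e : q.2 = ∑ i, ((hG i).memLp_smul_const hX (φ i)).toLp _ := by
    refine Lp.ext (h2.trans ?_)
    have h3 : ∀ᵐ ω ∂P, ∀ i, ((hG i).memLp_smul_const hX (φ i)).toLp _ ω =
        fderiv ℝ f (fun j => X (φ j) ω) (Pi.single i (1 : ℝ)) • φ i :=
      ae_all_iff.2 fun i => ((hG i).memLp_smul_const hX (φ i)).coeFn_toLp
    filter_upwards [h3, Lp.coeFn_finsetSum Finset.univ
      fun i => ((hG i).memLp_smul_const hX (φ i)).toLp _] with ω a b
    rw [b, Finset.sum_apply]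
    exact Finset.sum_congr rfl fun i _ => (a i).symm
  simp only [mem_ofPred_eq]
  rw [e, inner_sum]
  refine Finset.sum_eq_zero fun i _ => ?_
  have := (hG i).inner_smul_const hX (φ i) hV
  rw [this, inner_zero_left]

theorem mem_graphSubmodule_malliavinD (hX : IsIsonormal X P) {F : Lp ℝ 2 P} (hF : F ∈ D12 X P) :
    (F, malliavinD X P F) ∈ graphSubmodule X P := by
  rw [mem_graphSubmodule_iff hX]
  have h : ∃ U : Lp H 2 P, (F, U) ∈ malliavinGraph X P := hF
  rw [malliavinD, dif_pos h]
  exact h.choose_spec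

/-- Closability makes the choice in the definition of `malliavinD` immaterial. -/
theorem malliavinD_eq (hX : IsIsonormal X P) {F : Lp ℝ 2 P} {U : Lp H 2 P}
    (hF : (F, U) ∈ graphSubmodule X P) : malliavinD X P F = U := by
  have h1 := mem_graphSubmodule_malliavinD hX (F := F) ⟨U, (mem_graphSubmodule_iff hX).1 hF⟩
  have h2 := (graphSubmodule X P).sub_mem h1 hF
  rw [Prod.mk_sub_mk, sub_self] at h2
  exact sub_eq_zero.1 (eq_zero_of_mem_graphSubmodule hX h2)

end Duality

/-! ### Polynomials in `X(h)` and exponential moments -/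

section Polynomials

variable {H : Type*} [NormedAddCommGroup H] [InnerProductSpace ℝ H]
variable {Ω : Type*} [MeasurableSpace Ω] {P : Measure Ω} {X : H → Ω → ℝ}

/-- From `exp (2|x|) ≤ exp (2x) + exp (-2x)`. It bounds all polynomials in `X h`, and later
dominates the exponential series. -/
theorem IsIsonormal.memLp_exp_abs (hX : IsIsonormal X P) (h : H) :
    MemLp (fun ω => Real.exp |X h ω|) 2 P := by
  have hm := hX.aemeasurable h
  have hi : ∀ t : ℝ, Integrable (fun ω => Real.exp (t * X h ω)) P := fun t => by
    have h1 := integrable_exp_mul_gaussianReal (μ := P[X h]) (v := Var[X h; P].toNNReal) t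
    rw [← (hX.isGaussian.hasGaussianLaw_eval h).map_eq_gaussianReal] at h1
    exact h1.comp_aemeasurable hm
  have hms : AEStronglyMeasurable (fun ω => Real.exp |X h ω|) P :=
    Real.continuous_exp.comp_aestronglyMeasurable hm.aestronglyMeasurable.norm
  rw [memLp_two_iff_integrable_sq hms]
  refine ((hi 2).add (hi (-2))).mono' ?_ (ae_of_all _ fun ω => ?_)
  · exact hms.pow 2
  · rw [Real.norm_of_nonneg (by positivity), ← Real.exp_nat_mul]
    simp only [Pi.add_apply]
    rcases abs_cases (X h ω) with ⟨h1, -⟩ | ⟨h1, -⟩ <;> rw [h1]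
    · refine le_add_of_le_of_nonneg ?_ (Real.exp_pos _).le
      simp
    · refine le_add_of_nonneg_of_le (Real.exp_pos _).le ?_
      simp

theorem exists_abs_eval_le_exp (p : Polynomial ℝ) : ∃ C, ∀ x, |p.eval x| ≤ C * Real.exp |x| := by
  induction p using Polynomial.induction_on' with
  | add p q hp hq =>
    obtain ⟨C, hC⟩ := hp
    obtain ⟨D, hD⟩ := hq
    refine ⟨C + D, fun x => ?_⟩
    rw [Polynomial.eval_add, add_mul]
    exact (abs_add_le _ _).trans (add_le_add (hC x) (hD x))
  | monomial n a =>
    refine ⟨|a| * n.factorial, fun x => ?_⟩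
    rw [Polynomial.eval_monomial, abs_mul, mul_assoc, abs_pow]
    gcongr
    have := Real.pow_div_factorial_le_exp _ (abs_nonneg x) n
    rwa [div_le_iff₀ (by positivity), mul_comm] at this

theorem IsIsonormal.memLp_eval (hX : IsIsonormal X P) (h : H) (p : Polynomial ℝ) :
    MemLp (fun ω => p.eval (X h ω)) 2 P := by
  obtain ⟨C, hC⟩ := exists_abs_eval_le_exp p
  refine ((hX.memLp_exp_abs h).const_mul C).mono
    (p.continuous.comp_aestronglyMeasurable (hX.aemeasurable h).aestronglyMeasurable)
    (ae_of_all _ fun ω => ?_)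
  exact (hC _).trans (le_abs_self _)

theorem IsIsonormal.memLp_eval_smul (hX : IsIsonormal X P) (h : H) (p : Polynomial ℝ) :
    MemLp (fun ω => p.eval (X h ω) • h) 2 P := by
  refine ((hX.memLp_eval h p).norm.mul_const ‖h‖).mono
    ((hX.memLp_eval h p).aestronglyMeasurable.smul_const h) (ae_of_all _ fun ω => ?_)
  rw [norm_smul]
  exact le_abs_self _

/-- Polynomials in `X(h)` belong to the domain of the Malliavin derivative. -/
theorem eval_mem_graphSubmodule (hX : IsIsonormal X P) (h : H) (p : Polynomial ℝ) :
    ((hX.memLp_eval h p).toLp _, (hX.memLp_eval_smul h (Polynomial.derivative p)).toLp _) ∈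
      graphSubmodule X P := by
  have hd : ∀ x : Fin 1 → ℝ, HasFDerivAt (fun x : Fin 1 → ℝ => p.eval (x 0))
      ((Polynomial.derivative p).eval (x 0) •
        ContinuousLinearMap.proj (R := ℝ) (φ := fun _ : Fin 1 => ℝ) 0) x := fun x =>
    (p.hasDerivAt (x 0)).comp_hasFDerivAt (f := fun x : Fin 1 → ℝ => x 0) x
      (ContinuousLinearMap.proj (R := ℝ) (φ := fun _ : Fin 1 => ℝ) 0).hasFDerivAt
  rw [mem_graphSubmodule_iff hX]
  refine mem_malliavinGraph_of_memLp hX (n := 1) le_rfl (f := fun x => p.eval (x 0))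
    ((p.contDiff_aeval _).comp (contDiff_apply ℝ ℝ 0)) (fun _ => h) (hX.memLp_eval h p) ?_
    (hX.memLp_eval h p).coeFn_toLp
    ((hX.memLp_eval_smul h (Polynomial.derivative p)).coeFn_toLp.trans (ae_of_all _ fun ω => ?_))
  · simp only [(hd _).fderiv, norm_smul]
    exact (hX.memLp_eval h _).norm.mul_const _
  · simp only [cylGrad, (hd _).fderiv]
    simp

end Polynomials

/-! ### Hermite polynomials over the reals -/

section Hermite

/-- Hermite polynomials with real coefficients. -/
def hermiteReal (n : ℕ) : Polynomial ℝ := (Polynomial.hermite n).map (Int.castRingHom ℝ)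

theorem hermiteReal_zero : hermiteReal 0 = 1 := by simp [hermiteReal]

theorem hermiteReal_succ (n : ℕ) : hermiteReal (n + 1) =
    Polynomial.X * hermiteReal n - Polynomial.derivative (hermiteReal n) := by
  simp [hermiteReal, Polynomial.hermite_succ, Polynomial.derivative_map]

theorem eval_hermiteReal (n : ℕ) (x : ℝ) :
    (hermiteReal n).eval x = Polynomial.aeval x (Polynomial.hermite n) := by
  rw [hermiteReal, Polynomial.eval_map, Polynomial.aeval_def]
  rfl

theorem derivative_hermiteReal_succ (n : ℕ) :
    Polynomial.derivative (hermiteReal (n + 1)) = ((n : ℝ) + 1) • hermiteReal n := by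
  induction n with
  | zero => simp [hermiteReal_succ, hermiteReal_zero]
  | succ n ih =>
    rw [hermiteReal_succ (n + 1), Polynomial.derivative_sub, Polynomial.derivative_mul, ih,
      Polynomial.derivative_X, Polynomial.derivative_smul, hermiteReal_succ n]
    simp only [Polynomial.smul_eq_C_mul]
    push_cast
    simp only [map_add, map_natCast, map_one]
    ring

end Hermite

/-! ### Wiener chaoses as eigenspaces of `D* D` -/

section Chaos

variable {H : Type*} [NormedAddCommGroup H] [InnerProductSpace ℝ H]
variable {Ω : Type*} [MeasurableSpace Ω] {P : Measure Ω} {X : H → Ω → ℝ}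

theorem isClosed_graphSubmodule :
    IsClosed (graphSubmodule X P : Set (Lp ℝ 2 P × Lp H 2 P)) :=
  Submodule.isClosed_topologicalClosure _

/-- The divergence of `Hₘ(X(h)) h` is `Hₘ₊₁(X(h))`, by duality and `Hₘ₊₁ = x Hₘ - Hₘ'`. -/
theorem integral_hermite_mul_inner (hX : IsIsonormal X P) {h : H} (hh : ‖h‖ = 1) (m : ℕ)
    {G : Ω → ℝ} {V : Ω → H} (hG : IsBddCylinder X G V) :
    ∫ ω, (hermiteReal m).eval (X h ω) * inner ℝ (V ω) h ∂P =
      ∫ ω, (hermiteReal (m + 1)).eval (X h ω) * G ω ∂P := by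
  have h1 := hG.inner_smul_const hX h (eval_mem_graphSubmodule hX h (hermiteReal m))
  rw [L2.inner_def, L2.inner_def] at h1
  have hin : inner ℝ h h = (1 : ℝ) := by rw [real_inner_self_eq_norm_sq, hh]; norm_num
  have e1 : ∫ ω, inner ℝ ((hX.memLp_eval_smul h (Polynomial.derivative (hermiteReal m))).toLp _ ω)
      ((hG.memLp_smul_const hX h).toLp _ ω) ∂P =
      ∫ ω, (Polynomial.derivative (hermiteReal m)).eval (X h ω) * G ω ∂P := by
    refine integral_congr_ae ?_
    filter_upwards [(hX.memLp_eval_smul h (Polynomial.derivative (hermiteReal m))).coeFn_toLp,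
      (hG.memLp_smul_const hX h).coeFn_toLp] with ω a b
    rw [a, b, inner_smul_right, real_inner_smul_left, hin]; ring
  have e2 : ∫ ω, inner ℝ ((hX.memLp_eval h (hermiteReal m)).toLp _ ω)
      ((hG.memLp_mul_sub_inner hX h).toLp _ ω) ∂P =
      ∫ ω, ((Polynomial.X * hermiteReal m).eval (X h ω) * G ω -
        (hermiteReal m).eval (X h ω) * inner ℝ (V ω) h) ∂P := by
    refine integral_congr_ae ?_
    filter_upwards [(hX.memLp_eval h (hermiteReal m)).coeFn_toLp,
      (hG.memLp_mul_sub_inner hX h).coeFn_toLp] with ω a b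
    rw [a, b]; simp; ring
  have i1 : Integrable (fun ω => (Polynomial.X * hermiteReal m).eval (X h ω) * G ω) P :=
    (hX.memLp_eval h _).integrable_mul (hG.memLp_fst hX 2)
  have i2 : Integrable (fun ω => (hermiteReal m).eval (X h ω) * inner ℝ (V ω) h) P :=
    (hX.memLp_eval h _).integrable_mul ((hG.memLp_snd hX 2).inner_const h)
  have i3 : Integrable (fun ω =>
      (Polynomial.derivative (hermiteReal m)).eval (X h ω) * G ω) P :=
    (hX.memLp_eval h _).integrable_mul (hG.memLp_fst hX 2)
  rw [e1, e2, integral_sub i1 i2] at h1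
  simp only [hermiteReal_succ, Polynomial.eval_sub, sub_mul]
  rw [integral_sub i1 i3, h1]; ring

theorem isClosed_adjointEigenspace_graphSubmodule [CompleteSpace H] (m : ℕ) :
    IsClosed (adjointEigenspace (graphSubmodule X P) (m : ℝ) : Set (Lp ℝ 2 P)) := by
  have h1 := @isClosed_adjointEigenspace (Lp ℝ 2 P) (Lp H 2 P) _ _ _ _ _ (graphSubmodule X P)
    isClosed_graphSubmodule m (Nat.cast_nonneg m)
  exact h1

/-- The derivative of `Hₘ₊₁(X(h))` is `(m + 1) Hₘ(X(h)) h`, whose divergence is `(m + 1)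
Hₘ₊₁(X(h))`. Closedness of the eigenspace extends this from generators to the whole chaos. -/
theorem wienerChaos_le_adjointEigenspace [CompleteSpace H] (hX : IsIsonormal X P) (m : ℕ) :
    wienerChaos X P m ≤ adjointEigenspace (graphSubmodule X P) (m : ℝ) := by
  have := hX.isProbabilityMeasure
  cases m with
  | zero =>
    rw [wienerChaos]
    refine Submodule.topologicalClosure_minimal _ (Submodule.span_le.2 ?_)
      (isClosed_adjointEigenspace_graphSubmodule 0)
    intro F hF
    refine ⟨0, ?_, fun q _ => by simp⟩
    rw [mem_graphSubmodule_iff hX]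
    exact (IsBddCylinder.const X 1).mem_malliavinGraph hX hF (Lp.coeFn_zero _ _ _)
  | succ m =>
    rw [wienerChaos]
    refine Submodule.topologicalClosure_minimal _ (Submodule.span_le.2 ?_)
      (isClosed_adjointEigenspace_graphSubmodule (m + 1))
    rintro F ⟨h, hh, hF⟩
    set p := hermiteReal (m + 1) with hp
    have hFp : F = (hX.memLp_eval h p).toLp _ :=
      Lp.ext (hF.trans (by
        simp only [← eval_hermiteReal]
        exact (hX.memLp_eval h p).coeFn_toLp.symm))
    refine ⟨(hX.memLp_eval_smul h (Polynomial.derivative p)).toLp _, ?_, fun q hq => ?_⟩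
    · rw [hFp]; exact eval_mem_graphSubmodule hX h p
    · have hcl : IsClosed {q : Lp ℝ 2 P × Lp H 2 P |
          inner ℝ ((hX.memLp_eval_smul h (Polynomial.derivative p)).toLp _) q.2 =
            ((m + 1 : ℕ) : ℝ) * inner ℝ F q.1} :=
        isClosed_eq (by fun_prop) (by fun_prop)
      refine closure_minimal ?_ hcl hq
      rintro q ⟨G, V, hG, h1, h2⟩
      simp only [mem_ofPred_eq]
      rw [L2.inner_def, L2.inner_def]
      have e1 : ∫ ω, inner ℝ ((hX.memLp_eval_smul h (Polynomial.derivative p)).toLp _ ω)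
          (q.2 ω) ∂P = ∫ ω, ((m : ℝ) + 1) * ((hermiteReal m).eval (X h ω) * inner ℝ (V ω) h) ∂P := by
        refine integral_congr_ae ?_
        filter_upwards [(hX.memLp_eval_smul h (Polynomial.derivative p)).coeFn_toLp, h2] with ω a b
        rw [a, b, hp, derivative_hermiteReal_succ, real_inner_smul_left, Polynomial.eval_smul,
          real_inner_comm]
        simp; ring
      have e2 : ∫ ω, inner ℝ (F ω) (q.1 ω) ∂P = ∫ ω, p.eval (X h ω) * G ω ∂P := by
        refine integral_congr_ae ?_
        filter_upwards [hF, h1] with ω a b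
        rw [a, b, hp, eval_hermiteReal]; simp [mul_comm]
      rw [e1, e2, integral_const_mul, integral_hermite_mul_inner hX hh m hG]
      push_cast
      rfl

theorem inner_eq_zero_of_mem_wienerChaos [CompleteSpace H] (hX : IsIsonormal X P) {m n : ℕ}
    (hmn : m ≠ n) {F G : Lp ℝ 2 P} (hF : F ∈ wienerChaos X P m) (hG : G ∈ wienerChaos X P n) :
    inner ℝ F G = 0 :=
  inner_eq_zero_of_mem_adjointEigenspace (Nat.cast_injective.ne hmn)
    (wienerChaos_le_adjointEigenspace hX m hF) (wienerChaos_le_adjointEigenspace hX n hG)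

end Chaos

/-! ### Fourier uniqueness for signed densities -/

section SignedMeasure

variable {Ω : Type*} [MeasurableSpace Ω] {P : Measure Ω}

/-- A signed density whose image under `Y` has vanishing Fourier transform is orthogonal to all
bounded continuous functions of `Y`. -/
theorem integral_mul_comp_eq_zero_of_integral_mul_exp {E : Type*} [NormedAddCommGroup E]
    [NormedSpace ℝ E] [CompleteSpace E] [MeasurableSpace E] [BorelSpace E]
    [SecondCountableTopology E] {R : Ω → ℝ} (hR : Integrable R P) {Y : Ω → E}
    (hY : AEMeasurable Y P)
    (h : ∀ L : StrongDual ℝ E, ∫ ω, (R ω : ℂ) * Complex.exp (L (Y ω) * Complex.I) ∂P = 0)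
    {f : E → ℝ} (hf : Continuous f) {C : ℝ} (hC : ∀ x, ‖f x‖ ≤ C) :
    ∫ ω, R ω * f (Y ω) ∂P = 0 := by
  -- The positive and negative parts of `R` give two finite measures whose images under `Y` have the
  -- same characteristic function.
  set μ : Measure Ω := P.withDensity fun ω => ENNReal.ofReal (R ω) with hμ
  set ν : Measure Ω := P.withDensity fun ω => ENNReal.ofReal (-R ω) with hν
  have : IsFiniteMeasure μ := isFiniteMeasure_withDensity_ofReal hR.2
  have : IsFiniteMeasure ν := isFiniteMeasure_withDensity_ofReal hR.neg.2
  have hYμ : AEMeasurable Y μ := hY.mono_ac (withDensity_absolutelyContinuous _ _)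
  have hYν : AEMeasurable Y ν := hY.mono_ac (withDensity_absolutelyContinuous _ _)
  have hRn : AEMeasurable (fun ω => -R ω) P := hR.1.aemeasurable.neg
  have key : ∀ {F : Type} [NormedAddCommGroup F] [NormedSpace ℝ F] [SecondCountableTopology F]
      (u : E → F) (D : ℝ), Continuous u → (∀ x, ‖u x‖ ≤ D) →
      ∫ x, u x ∂(μ.map Y) - ∫ x, u x ∂(ν.map Y) = ∫ ω, R ω • u (Y ω) ∂P := by
    intro F _ _ _ u D hu hD
    have hu' : AEStronglyMeasurable (fun ω => u (Y ω)) P :=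
      hu.stronglyMeasurable.aestronglyMeasurable.comp_aemeasurable hY
    rw [integral_map hYμ hu.aestronglyMeasurable, integral_map hYν hu.aestronglyMeasurable,
      hμ, hν, integral_withDensity_eq_integral_toReal_smul₀ hR.1.aemeasurable.ennreal_ofReal
        (ae_of_all _ fun _ => ENNReal.ofReal_lt_top),
      integral_withDensity_eq_integral_toReal_smul₀ hRn.ennreal_ofReal
        (ae_of_all _ fun _ => ENNReal.ofReal_lt_top), ← integral_sub]
    · congr 1; ext ω
      rw [← sub_smul, ENNReal.toReal_ofReal', ENNReal.toReal_ofReal']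
      congr 1
      rcases le_total 0 (R ω) with h | h
      · rw [max_eq_left h, max_eq_right (by linarith)]; ring
      · rw [max_eq_right h, max_eq_left (by linarith)]; ring
    · simp only [ENNReal.toReal_ofReal']
      exact hR.pos_part.smul_bdd D hu' (ae_of_all _ fun ω => hD _)
    · simp only [ENNReal.toReal_ofReal']
      exact hR.neg_part.smul_bdd D hu' (ae_of_all _ fun ω => hD _)
  have heq : μ.map Y = ν.map Y := by
    refine Measure.ext_of_charFunDual (funext fun L => sub_eq_zero.1 ?_)
    rw [charFunDual_apply, charFunDual_apply, key _ 1 (by fun_prop)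
      (fun x => (Complex.norm_exp_ofReal_mul_I _).le), ← h L]
    simp
  have := key f C hf hC
  rw [heq, sub_self] at this
  simpa using this.symm

end SignedMeasure

/-! ### Completeness of the chaos decomposition -/

section Completeness

variable {H : Type*} [NormedAddCommGroup H] [InnerProductSpace ℝ H]
variable {Ω : Type*} [MeasurableSpace Ω] {P : Measure Ω} {X : H → Ω → ℝ}

theorem integral_mul_const_eq_zero (hX : IsIsonormal X P) {R : Lp ℝ 2 P}
    (hR : ∀ m, ∀ F ∈ wienerChaos X P m, inner ℝ R F = 0) (c : ℝ) : ∫ ω, R ω * c ∂P = 0 := by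
  have := hX.isProbabilityMeasure
  have h1 := hR 0 ((memLp_const (1 : ℝ)).toLp _)
    (Submodule.le_topologicalClosure _ (Submodule.subset_span (MemLp.coeFn_toLp _)))
  rw [L2.inner_def] at h1
  have h2 : ∫ ω, R ω ∂P = 0 := by
    rw [← h1]
    refine integral_congr_ae ?_
    filter_upwards [(memLp_const (μ := P) (p := 2) (1 : ℝ)).coeFn_toLp] with ω a
    rw [a]; simp
  rw [integral_mul_const, h2, zero_mul]

theorem integral_mul_hermite_eq_zero (hX : IsIsonormal X P) {R : Lp ℝ 2 P}
    (hR : ∀ m, ∀ F ∈ wienerChaos X P m, inner ℝ R F = 0) {h : H} (hh : ‖h‖ = 1) (m : ℕ) :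
    ∫ ω, R ω * (hermiteReal m).eval (X h ω) ∂P = 0 := by
  cases m with
  | zero => simpa [hermiteReal_zero] using integral_mul_const_eq_zero hX hR 1
  | succ m =>
    have h2 : (hX.memLp_eval h (hermiteReal (m + 1))).toLp _ ∈ wienerChaos X P (m + 1) := by
      refine Submodule.le_topologicalClosure _ (Submodule.subset_span ⟨h, hh, ?_⟩)
      simp only [← eval_hermiteReal]
      exact (hX.memLp_eval h _).coeFn_toLp
    have h1 := hR (m + 1) _ h2
    rw [L2.inner_def] at h1
    rw [← h1]
    refine integral_congr_ae ?_
    filter_upwards [(hX.memLp_eval h (hermiteReal (m + 1))).coeFn_toLp] with ω a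
    rw [a]; simp [mul_comm]

/-- The relation `x Hₖ = Hₖ₊₁ + Hₖ'` trades a power of `x` for neighbouring Hermite polynomials;
keeping `k` free makes the induction close. -/
theorem integral_mul_pow_mul_hermite_eq_zero (hX : IsIsonormal X P) {R : Lp ℝ 2 P}
    (hR : ∀ m, ∀ F ∈ wienerChaos X P m, inner ℝ R F = 0) {h : H} (hh : ‖h‖ = 1) (n k : ℕ) :
    ∫ ω, R ω * (Polynomial.X ^ n * hermiteReal k).eval (X h ω) ∂P = 0 := by
  induction n generalizing k with
  | zero => simpa using integral_mul_hermite_eq_zero hX hR hh k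
  | succ n ih =>
    have hi : ∀ p : Polynomial ℝ, Integrable (fun ω => R ω * p.eval (X h ω)) P := fun p =>
      (Lp.memLp R).integrable_mul (hX.memLp_eval h p)
    have e : Polynomial.X ^ (n + 1) * hermiteReal k = Polynomial.X ^ n * hermiteReal (k + 1) +
        Polynomial.X ^ n * Polynomial.derivative (hermiteReal k) := by
      rw [hermiteReal_succ]; ring
    simp only [e, Polynomial.eval_add, mul_add]
    rw [integral_add (hi _) (hi _), ih, zero_add]
    cases k with
    | zero => simp [hermiteReal_zero]
    | succ k =>
      have := ih k
      simp only [derivative_hermiteReal_succ, Polynomial.eval_mul, Polynomial.eval_smul,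
        smul_eq_mul] at this ⊢
      have e2 : ∀ ω, R ω * ((Polynomial.X ^ n : Polynomial ℝ).eval (X h ω) *
          (((k : ℝ) + 1) * (hermiteReal k).eval (X h ω))) = ((k : ℝ) + 1) *
          (R ω * ((Polynomial.X ^ n : Polynomial ℝ).eval (X h ω) *
            (hermiteReal k).eval (X h ω))) := fun ω => by ring
      simp only [e2]
      rw [integral_const_mul, this, mul_zero]

theorem integral_mul_pow_eq_zero (hX : IsIsonormal X P) {R : Lp ℝ 2 P}
    (hR : ∀ m, ∀ F ∈ wienerChaos X P m, inner ℝ R F = 0) (h : H) (n : ℕ) :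
    ∫ ω, R ω * X h ω ^ n ∂P = 0 := by
  by_cases h0 : h = 0
  · rw [← integral_mul_const_eq_zero hX hR (0 ^ n)]
    refine integral_congr_ae ?_
    filter_upwards [hX.map_smul 0 (0 : H)] with ω hω
    simp only [zero_smul, zero_mul] at hω
    rw [h0, hω]
  · have hn : ‖h‖ ≠ 0 := norm_ne_zero_iff.2 h0
    have he : ‖‖h‖⁻¹ • h‖ = 1 := by rw [norm_smul, norm_inv, norm_norm, inv_mul_cancel₀ hn]
    have h1 := integral_mul_pow_mul_hermite_eq_zero hX hR he n 0
    simp only [hermiteReal_zero, mul_one, Polynomial.eval_pow, Polynomial.eval_X] at h1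
    rw [← mul_zero (‖h‖ ^ n), ← h1, ← integral_const_mul]
    refine integral_congr_ae ?_
    filter_upwards [hX.map_smul ‖h‖⁻¹ h] with ω hω
    rw [hω, mul_pow, inv_pow]
    field_simp

theorem integral_mul_exp_eq_zero (hX : IsIsonormal X P) {R : Lp ℝ 2 P}
    (hR : ∀ m, ∀ F ∈ wienerChaos X P m, inner ℝ R F = 0) (h : H) :
    ∫ ω, (R ω : ℂ) * Complex.exp (X h ω * Complex.I) ∂P = 0 := by
  have hRm := (Lp.memLp R).aestronglyMeasurable
  have hXm := (hX.aemeasurable h).aestronglyMeasurable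
  have hs := hasSum_integral_of_dominated_convergence (μ := P)
    (F := fun (n : ℕ) ω => (R ω : ℂ) * ((X h ω * Complex.I) ^ n / n.factorial))
    (f := fun ω => (R ω : ℂ) * Complex.exp (X h ω * Complex.I))
    (fun n ω => |R ω| * (|X h ω| ^ n / n.factorial)) (fun n => ?_) (fun n => ?_) ?_ ?_ ?_
  · refine hs.unique ?_
    convert! hasSum_zero using 1
    ext n
    have e : ∀ ω, (R ω : ℂ) * ((X h ω * Complex.I) ^ n / n.factorial) =
        (Complex.I ^ n / n.factorial) * ((R ω * X h ω ^ n : ℝ) : ℂ) := fun ω => by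
      push_cast; rw [mul_pow]; ring
    simp only [e]
    rw [integral_const_mul, integral_complex_ofReal, integral_mul_pow_eq_zero hX hR]
    simp
  · refine (Complex.continuous_ofReal.comp_aestronglyMeasurable hRm).mul ?_
    exact Continuous.comp_aestronglyMeasurable
      (g := fun x : ℝ => ((x : ℂ) * Complex.I) ^ n / n.factorial) (by fun_prop) hXm
  · refine ae_of_all _ fun ω => ?_
    simp
  · exact ae_of_all _ fun ω => (Real.summable_pow_div_factorial _).mul_left _
  · have e : ∀ ω, ∑' n : ℕ, |R ω| * (|X h ω| ^ n / n.factorial) =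
        |R ω| * Real.exp |X h ω| := fun ω => by
      rw [tsum_mul_left, Real.exp_eq_exp_ℝ, NormedSpace.exp_eq_tsum_div]
    simp only [e]
    exact (Lp.memLp R).norm.integrable_mul (hX.memLp_exp_abs h)
  · refine ae_of_all _ fun ω => HasSum.mul_left _ ?_
    rw [Complex.exp_eq_exp_ℂ]
    exact NormedSpace.expSeries_div_hasSum_exp _

/-- The Wiener chaos decomposition is complete: a variable which is orthogonal to all the chaoses
is orthogonal to all bounded continuous cylindrical variables. -/
theorem integral_mul_cylinder_eq_zero (hX : IsIsonormal X P) {R : Lp ℝ 2 P}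
    (hR : ∀ m, ∀ F ∈ wienerChaos X P m, inner ℝ R F = 0) {n : ℕ} {f : (Fin n → ℝ) → ℝ}
    (hf : Continuous f) {C : ℝ} (hC : ∀ x, ‖f x‖ ≤ C) (φ : Fin n → H) :
    ∫ ω, R ω * f (fun j => X (φ j) ω) ∂P = 0 := by
  have := hX.isProbabilityMeasure
  refine integral_mul_comp_eq_zero_of_integral_mul_exp ((Lp.memLp R).integrable (by simp))
    (hX.aemeasurable_pi φ) (fun L => ?_) hf hC
  -- By linearity of `X`, each linear form of the vector `(X (φ j))` is a single `X h`.
  rw [← integral_mul_exp_eq_zero hX hR (∑ i, L (Pi.single i 1) • φ i)]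
  refine integral_congr_ae ?_
  filter_upwards [hX.map_sum_smul (fun i => L (Pi.single i 1)) φ] with ω hω
  have : L (fun j => X (φ j) ω) = ∑ i, L (Pi.single i 1) * X (φ i) ω := by
    conv_lhs => rw [← Finset.univ_sum_single (fun j => X (φ j) ω), map_sum]
    refine Finset.sum_congr rfl fun i _ => ?_
    have e : (Pi.single i (X (φ i) ω) : Fin n → ℝ) = (X (φ i) ω) • Pi.single i (1 : ℝ) := by
      rw [← Pi.single_smul]; simp
    rw [e, _root_.map_smul, smul_eq_mul, mul_comm]
  rw [this, hω]

/-- Completeness is needed only against the domain of `D`. Against all of `L²(Ω)` it may fail, since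
the σ-algebra can be larger than the one generated by `X`. -/
theorem inner_eq_zero_of_mem_graphSubmodule (hX : IsIsonormal X P) {R : Lp ℝ 2 P}
    (hR : ∀ m, ∀ F ∈ wienerChaos X P m, inner ℝ R F = 0) {q : Lp ℝ 2 P × Lp H 2 P}
    (hq : q ∈ graphSubmodule X P) : inner ℝ R q.1 = 0 := by
  have hcl : IsClosed {q : Lp ℝ 2 P × Lp H 2 P | inner ℝ R q.1 = 0} :=
    isClosed_eq (by fun_prop) continuous_const
  refine closure_minimal ?_ hcl hq
  rintro q ⟨F, U, ⟨n, f, φ, hn, hf, rfl, rfl⟩, h1, h2⟩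
  obtain ⟨C, hC⟩ := hf.bdd
  simp only [mem_ofPred_eq]
  rw [L2.inner_def, ← integral_mul_cylinder_eq_zero hX hR hf.contDiff.continuous hC φ]
  refine integral_congr_ae ?_
  filter_upwards [h1] with ω a
  rw [a]; simp [mul_comm]

end Completeness

/-! ### The operator `-L⁻¹` inverts `D* D` -/

section InverseGenerator

variable {H : Type*} [NormedAddCommGroup H] [InnerProductSpace ℝ H] [CompleteSpace H]
variable {Ω : Type*} [MeasurableSpace Ω] {P : Measure Ω} {X : H → Ω → ℝ}

/-- `D* D (-L⁻¹ Z) = Z` for centered `Z`, in weak form. -/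
theorem inner_neg_malliavinD_ouInv (hX : IsIsonormal X P) {Z : Lp ℝ 2 P}
    (hZ : ∫ ω, Z ω ∂P = 0)
    {q : Lp ℝ 2 P × Lp H 2 P} (hq : q ∈ graphSubmodule X P) :
    inner ℝ (-malliavinD X P (ouInv X P Z)) q.2 = inner ℝ Z q.1 := by
  set K : ℕ → Submodule ℝ (Lp ℝ 2 P) := fun m => wienerChaos X P (m + 1) with hK
  have horth : ∀ m n, m ≠ n → ∀ x ∈ K m, ∀ y ∈ K n, inner ℝ x y = 0 := fun m n hmn x hx y hy =>
    inner_eq_zero_of_mem_wienerChaos hX (by omega) hx hy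
  have hc : ∀ m : ℕ, ‖1 / ((m : ℝ) + 1)‖ ≤ 1 := fun m => by
    rw [Real.norm_of_nonneg (by positivity)]
    exact div_le_one_of_le₀ (by simp) (by positivity)
  have hs' := summable_smul_starProjection horth hc Z
  have hs : Summable fun m => (K m).starProjection Z := by
    simpa using summable_smul_starProjection horth (c := fun _ => 1) (by simp) Z
  obtain ⟨V, hV, hVq⟩ := exists_adjoint_inverse (isClosed_graphSubmodule (X := X) (P := P))
    (F := fun m => (K m).starProjection Z) (fun m => by
      have := wienerChaos_le_adjointEigenspace hX (m + 1)
        (Submodule.starProjection_apply_mem (K m) Z)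
      simpa using this) hs hs'
  have hW : ouInv X P Z = -∑' m : ℕ, (1 / ((m : ℝ) + 1)) • (K m).starProjection Z := by
    rw [ouInv, ← tsum_neg]
    simp only [neg_smul]
    rfl
  have hD : malliavinD X P (ouInv X P Z) = -V := by
    refine malliavinD_eq hX ?_
    rw [hW]
    exact (graphSubmodule X P).neg_mem hV
  rw [hD, neg_neg, hVq q hq]
  -- The remainder is orthogonal to the chaoses of order at least one by construction, and to the
  -- constants because `Z` is centered.
  have hR : ∀ m, ∀ F ∈ wienerChaos X P m,
      inner ℝ (Z - ∑' m, (K m).starProjection Z) F = 0 := by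
    intro m F hF
    rw [inner_sub_left]
    cases m with
    | zero =>
      have h1 : inner ℝ Z F = 0 := by
        have hle : wienerChaos X P 0 ≤ (Submodule.span ℝ {Z})ᗮ := by
          rw [wienerChaos]
          refine Submodule.topologicalClosure_minimal _ (Submodule.span_le.2 fun G hG => ?_)
            (Submodule.isClosed_orthogonal _)
          rw [SetLike.mem_coe, Submodule.mem_orthogonal_singleton_iff_inner_right, L2.inner_def,
            ← hZ]
          refine integral_congr_ae ?_
          filter_upwards [hG] with ω a
          rw [a]; simp
        exact Submodule.mem_orthogonal_singleton_iff_inner_right.1 (hle hF)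
      rw [h1, inner_tsum_starProjection_eq_zero, sub_zero]
      exact fun m y hy => inner_eq_zero_of_mem_wienerChaos hX (by omega) hy hF
    | succ m => rw [inner_tsum_starProjection horth Z hF, sub_self]
  have h2 := inner_eq_zero_of_mem_graphSubmodule hX hR hq
  rw [inner_sub_left] at h2
  linarith

end InverseGenerator

/-! ### Integration by parts for `Z` -/

section SteinIdentityForZ

variable {H : Type*} [NormedAddCommGroup H] [InnerProductSpace ℝ H] [CompleteSpace H]
variable {Ω : Type*} [MeasurableSpace Ω] {P : Measure Ω} {X : H → Ω → ℝ}

omit [CompleteSpace H] in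
theorem integrable_steinInner (F : Lp ℝ 2 P) : Integrable (steinInner X P F) P :=
  (L2.integrable_inner (malliavinD X P F) (malliavinD X P (ouInv X P F))).neg.congr
    (ae_of_all _ fun ω => by simp [steinInner])

omit [CompleteSpace H] in
-- This is `D* V = Z` tested on `u(F)`. For cylinders the chain rule applies. In the limit `u'` is
-- attached to the fixed `V`: `u'(Fₙ) V` converges by domination along an a.e. convergent
-- subsequence, while `DFₙ` converges in `L²`, so no bound on `DFₙ` is needed.
theorem inner_deriv_smul_of_mem_graphSubmodule (hX : IsIsonormal X P) {V : Lp H 2 P}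
    {F Z : Lp ℝ 2 P} {U : Lp H 2 P} (hF : (F, U) ∈ graphSubmodule X P)
    (hV : ∀ q ∈ graphSubmodule X P, inner ℝ V q.2 = inner ℝ Z q.1) {u : ℝ → ℝ}
    (hu : ContDiff ℝ (⊤ : ℕ∞) u) (hu0 : u 0 = 0) {K : ℝ} (hK : ∀ x, ‖deriv u x‖ ≤ K) :
    ∫ ω, deriv u (F ω) * inner ℝ (U ω) (V ω) ∂P = ∫ ω, u (F ω) * Z ω ∂P := by
  have hu'c : Continuous (deriv u) := hu.continuous_deriv (by simp)
  have hK0 : 0 ≤ K := (norm_nonneg _).trans (hK 0)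
  have hlip : LipschitzWith K.toNNReal u :=
    lipschitzWith_of_nnnorm_deriv_le (hu.differentiable (by simp)) fun x => by
      rw [← NNReal.coe_le_coe, Real.coe_toNNReal _ hK0]; exact hK x
  obtain ⟨q, hq, hlim⟩ := mem_closure_iff_seq_limit.1 (show _ ∈ closure _ from hF)
  have hlim1 : Tendsto (fun n => (q n).1) atTop (𝓝 F) := (continuous_fst.tendsto _).comp hlim
  have hlim2 : Tendsto (fun n => (q n).2) atTop (𝓝 U) := (continuous_snd.tendsto _).comp hlim
  obtain ⟨ns, hns, hae⟩ := (tendstoInMeasure_of_tendsto_Lp hlim1).exists_seq_tendsto_ae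
  have hmem : ∀ G : Lp ℝ 2 P, MemLp (fun ω => deriv u (G ω) • V ω) 2 P := fun G => by
    refine ((Lp.memLp V).norm.const_mul K).mono ((hu'c.comp_aestronglyMeasurable
      (Lp.aestronglyMeasurable G)).smul (Lp.aestronglyMeasurable V)) (ae_of_all _ fun ω => ?_)
    rw [norm_smul]
    refine le_trans ?_ (le_abs_self _)
    gcongr
    exact hK _
  have t1 := tendsto_toLp_two_of_dominated (fun k => hmem (q (ns k)).1) (hmem F)
    ((Lp.memLp V).norm.const_mul K)
    (fun k => ae_of_all _ fun ω => by
      rw [norm_smul]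
      gcongr
      exact hK _)
    (by
      filter_upwards [hae] with ω hω
      exact ((hu'c.tendsto _).comp hω).smul_const _)
  have t2 : Tendsto (fun k => hlip.compLp hu0 (q (ns k)).1) atTop (𝓝 (hlip.compLp hu0 F)) :=
    ((hlip.continuous_compLp hu0).tendsto F).comp (hlim1.comp hns.tendsto_atTop)
  have hk : ∀ k, inner ℝ ((hmem (q (ns k)).1).toLp _) (q (ns k)).2 =
      inner ℝ Z (hlip.compLp hu0 (q (ns k)).1) := fun k => by
    obtain ⟨G, W, hG, h1, h2⟩ := hq (ns k)
    have hG' := hG.scomp hu hK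
    have h3 := hV ((hG'.memLp_fst hX 2).toLp _, (hG'.memLp_snd hX 2).toLp _)
      ((mem_graphSubmodule_iff hX).2 (hG'.mem_malliavinGraph hX (hG'.memLp_fst hX 2).coeFn_toLp
        (hG'.memLp_snd hX 2).coeFn_toLp))
    have e1 : hlip.compLp hu0 (q (ns k)).1 = (hG'.memLp_fst hX 2).toLp _ := by
      refine Lp.ext ((hlip.coeFn_compLp hu0 _).trans ?_)
      filter_upwards [h1, (hG'.memLp_fst hX 2).coeFn_toLp] with ω a b
      rw [b, Function.comp_apply, a]
    rw [e1]
    refine Eq.trans ?_ h3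
    rw [L2.inner_def, L2.inner_def]
    refine integral_congr_ae ?_
    filter_upwards [h1, h2, (hmem (q (ns k)).1).coeFn_toLp,
      (hG'.memLp_snd hX 2).coeFn_toLp] with ω a b c d
    rw [c, d, a, b, real_inner_smul_left, real_inner_smul_right]
  have h4 := tendsto_nhds_unique (t1.inner (hlim2.comp hns.tendsto_atTop))
    ((tendsto_const_nhds.inner t2).congr fun k => (hk k).symm)
  rw [L2.inner_def, L2.inner_def] at h4
  refine Eq.trans ?_ (h4.trans ?_) <;> refine integral_congr_ae ?_
  · filter_upwards [(hmem F).coeFn_toLp] with ω a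
    rw [a, real_inner_smul_left, real_inner_comm]
  · filter_upwards [hlip.coeFn_compLp hu0 F] with ω a
    rw [a]; simp

/-- The integration by parts formula `E(u'(Z) g(Z)) = E(u(Z) Z)` for the conditional expectation
`g(Z)` of `⟪DZ, -DL⁻¹Z⟫`. -/
theorem integral_deriv_mul_condExp [IsProbabilityMeasure P] (hX : IsIsonormal X P)
    {Z : Ω → ℝ} (hZm : Measurable Z) (hZ2 : MemLp Z 2 P) (hZD : hZ2.toLp Z ∈ D12 X P)
    (hZ0 : ∫ ω, Z ω ∂P = 0) {g : ℝ → ℝ}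
    (hg : IsCondExpGiven P (steinInner X P (hZ2.toLp Z)) Z g) {u : ℝ → ℝ}
    (hu : ContDiff ℝ (⊤ : ℕ∞) u) (hu0 : u 0 = 0) {K : ℝ} (hK : ∀ x, ‖deriv u x‖ ≤ K) :
    ∫ ω, deriv u (Z ω) * g (Z ω) ∂P = ∫ ω, u (Z ω) * Z ω ∂P := by
  have hu'c : Continuous (deriv u) := hu.continuous_deriv (by simp)
  have hm : MeasurableSpace.comap Z inferInstance ≤ ‹MeasurableSpace Ω› := hZm.comap_le
  set Y := steinInner X P (hZ2.toLp Z) with hY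
  have hYi : Integrable Y P := integrable_steinInner _
  have hZae := hZ2.coeFn_toLp
  have hZ0' : ∫ ω, hZ2.toLp Z ω ∂P = 0 := by rw [integral_congr_ae hZae, hZ0]
  have h1 := inner_deriv_smul_of_mem_graphSubmodule hX
    (V := -malliavinD X P (ouInv X P (hZ2.toLp Z)))
    (mem_graphSubmodule_malliavinD hX hZD) (fun q hq => inner_neg_malliavinD_ouInv hX hZ0' hq)
    hu hu0 hK
  have h2 : ∫ ω, deriv u (Z ω) * Y ω ∂P = ∫ ω, u (Z ω) * Z ω ∂P := by
    refine Eq.trans ?_ (h1.trans ?_) <;> refine integral_congr_ae ?_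
    · filter_upwards [hZae, Lp.coeFn_neg (malliavinD X P (ouInv X P (hZ2.toLp Z)))] with ω a b
      rw [a, b]; rfl
    · filter_upwards [hZae] with ω a
      rw [a]
  have hsm : StronglyMeasurable[MeasurableSpace.comap Z inferInstance]
      (fun ω => deriv u (Z ω)) :=
    (hu'c.measurable.comp (comap_measurable Z)).stronglyMeasurable
  have hi : Integrable ((fun ω => deriv u (Z ω)) * Y) P :=
    hYi.bdd_mul (c := K) (hu'c.measurable.comp hZm).aestronglyMeasurable (ae_of_all _ fun ω => hK _)
  have h3 := condExp_mul_of_stronglyMeasurable_left hsm hi hYi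
  rw [← h2]
  calc ∫ ω, deriv u (Z ω) * g (Z ω) ∂P
      = ∫ ω, (P[(fun ω => deriv u (Z ω)) * Y | MeasurableSpace.comap Z inferInstance]) ω ∂P := by
        refine integral_congr_ae ?_
        filter_upwards [h3, hg.2] with ω a b
        rw [a, Pi.mul_apply, ← b]
    _ = _ := integral_condExp hm

end SteinIdentityForZ

/-! ### The tail moment `Ψ` of a centered law -/

section SteinKernel

variable {μ : Measure ℝ}

/-- The function `x ↦ ∫_{[x, ∞)} z dμ(z)` of a centered law `μ`, in a form where all the terms are
nonnegative. -/
def upperMoment (μ : Measure ℝ) (x : ℝ) : ℝ :=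
  ∫ z, (uIoc 0 z).indicator (fun _ => |z|) x ∂μ

theorem measurable_indicator_uIoc :
    Measurable fun p : ℝ × ℝ => (uIoc 0 p.2).indicator (fun _ => |p.2|) p.1 := by
  have hs : MeasurableSet {p : ℝ × ℝ | p.1 ∈ uIoc 0 p.2} := by
    simp only [uIoc, mem_Ioc]
    exact (measurableSet_lt (measurable_const.min measurable_snd) measurable_fst).inter
      (measurableSet_le measurable_fst (measurable_const.max measurable_snd))
  exact (Measurable.indicator (f := fun p : ℝ × ℝ => |p.2|) (by fun_prop) hs)

theorem indicator_uIoc_nonneg (x z : ℝ) : 0 ≤ (uIoc 0 z).indicator (fun _ => |z|) x :=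
  indicator_nonneg (fun _ _ => abs_nonneg z) _

theorem upperMoment_nonneg (x : ℝ) : 0 ≤ upperMoment μ x :=
  integral_nonneg fun z => indicator_uIoc_nonneg x z

/-- For negative `z` the orientation of the interval integral and the sign of `z` cancel. -/
theorem integral_indicator_uIoc (z : ℝ) (v : ℝ → ℝ) :
    ∫ x, v x * (uIoc 0 z).indicator (fun _ => |z|) x = (∫ x in (0 : ℝ)..z, v x) * z := by
  have h1 : ∀ x, v x * (uIoc 0 z).indicator (fun _ => |z|) x =
      (uIoc 0 z).indicator (fun x => v x * |z|) x := fun x => by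
    by_cases hx : x ∈ uIoc 0 z <;> simp [hx]
  simp only [h1]
  rw [integral_indicator measurableSet_uIoc, integral_mul_const,
    intervalIntegral.intervalIntegral_eq_integral_uIoc, smul_eq_mul]
  split_ifs with h
  · rw [abs_of_nonneg h]; ring
  · rw [abs_of_nonpos (not_le.1 h).le]; ring

theorem integrable_indicator_uIoc [IsFiniteMeasure μ] (h2 : Integrable (fun z => z ^ 2) μ) :
    Integrable (fun p : ℝ × ℝ => (uIoc 0 p.2).indicator (fun _ => |p.2|) p.1)
      (volume.prod μ) := by
  rw [integrable_prod_iff' measurable_indicator_uIoc.aestronglyMeasurable]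
  constructor
  · refine ae_of_all _ fun z => ?_
    change Integrable ((uIoc 0 z).indicator fun _ => |z|) volume
    rw [integrable_indicator_iff measurableSet_uIoc]
    exact integrableOn_const (by simp [uIoc])
  · refine h2.congr (ae_of_all _ fun z => ?_)
    have := integral_indicator_uIoc z (fun _ => 1)
    simp only [one_mul, intervalIntegral.integral_const, smul_eq_mul, mul_one, sub_zero] at this
    simp only [Real.norm_of_nonneg (indicator_uIoc_nonneg _ _)]
    rw [this, sq]

theorem integrable_upperMoment [IsFiniteMeasure μ] (h2 : Integrable (fun z => z ^ 2) μ) :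
    Integrable (upperMoment μ) :=
  (integrable_indicator_uIoc h2).integral_prod_left

theorem measurable_upperMoment [IsFiniteMeasure μ] : Measurable (upperMoment μ) :=
  (measurable_indicator_uIoc.stronglyMeasurable.integral_prod_right').measurable

/-- Fubini, legitimate because the total mass of the kernel is the second moment. With `v = u'` and
`u 0 = 0` the right side is `∫ u(z) z dμ`. -/
theorem integral_mul_upperMoment [IsFiniteMeasure μ] (h2 : Integrable (fun z => z ^ 2) μ)
    {v : ℝ → ℝ} (hv : Continuous v) {C : ℝ} (hC : ∀ x, ‖v x‖ ≤ C) :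
    ∫ x, v x * upperMoment μ x = ∫ z, (∫ x in (0 : ℝ)..z, v x) * z ∂μ := by
  have hi : Integrable (fun p : ℝ × ℝ => v p.1 * (uIoc 0 p.2).indicator (fun _ => |p.2|) p.1)
      (volume.prod μ) :=
    (integrable_indicator_uIoc h2).bdd_mul (c := C)
      (Continuous.aestronglyMeasurable (by fun_prop)) (ae_of_all _ fun p => hC _)
  simp only [← integral_indicator_uIoc, upperMoment, ← integral_const_mul]
  exact integral_integral_swap hi

/-- For `x ≤ 0` the kernel gives `∫_{z < x} -z dμ`; centering turns it into the upper tail. -/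
theorem upperMoment_eq_setIntegral (h1 : Integrable (fun z => z) μ) (h0 : ∫ z, z ∂μ = 0)
    (x : ℝ) : upperMoment μ x = ∫ z in Ici x, z ∂μ := by
  rcases lt_or_ge 0 x with hx | hx
  · rw [upperMoment, ← integral_indicator measurableSet_Ici]
    congr 1; ext z
    by_cases hz : x ≤ z
    · have : x ∈ uIoc 0 z := by rw [uIoc_of_le (hx.le.trans hz)]; exact ⟨hx, hz⟩
      rw [indicator_of_mem this, indicator_of_mem (mem_Ici.2 hz), abs_of_nonneg (hx.le.trans hz)]
    · have : x ∉ uIoc 0 z := by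
        rw [mem_uIoc]; push Not at hz ⊢; exact ⟨fun _ => hz, fun _ => hx⟩
      rw [indicator_of_notMem this, indicator_of_notMem (by simpa using hz)]
  · have h3 : ∫ z in Ici x, z ∂μ = ∫ z in Iio x, -z ∂μ := by
      have := integral_add_compl (measurableSet_Ici (a := x)) h1
      rw [h0, compl_Ici] at this
      rw [integral_neg]; linarith
    rw [h3, upperMoment, ← integral_indicator measurableSet_Iio]
    congr 1; ext z
    by_cases hz : z < x
    · have : x ∈ uIoc 0 z := by rw [uIoc_of_ge (hz.le.trans hx)]; exact ⟨hz, hx⟩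
      rw [indicator_of_mem this, indicator_of_mem (mem_Iio.2 hz), abs_of_nonpos (hz.le.trans hx)]
    · have : x ∉ uIoc 0 z := by
        rw [mem_uIoc]; push Not at hz ⊢
        exact ⟨fun h => absurd hx (not_le.2 h), fun h => absurd h (not_lt.2 hz)⟩
      rw [indicator_of_notMem this, indicator_of_notMem (by simpa using hz)]

end SteinKernel

/-! ### Identification of `g μ` with `Ψ dx` -/

section IdentifyMeasure

theorem integral_mul_cexp {m : Measure ℝ} {w : ℝ → ℝ} (hw : Integrable w m) (t : ℝ) :
    ∫ x, (w x : ℂ) * Complex.exp (t * x * Complex.I) ∂m =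
      ((∫ x, Real.cos (t * x) * w x ∂m : ℝ) : ℂ) +
        ((∫ x, Real.sin (t * x) * w x ∂m : ℝ) : ℂ) * Complex.I := by
  have i1 : Integrable (fun x => Real.cos (t * x) * w x) m :=
    hw.bdd_mul (c := 1) (Continuous.aestronglyMeasurable (by fun_prop))
      (ae_of_all _ fun x => Real.abs_cos_le_one _)
  have i2 : Integrable (fun x => Real.sin (t * x) * w x) m :=
    hw.bdd_mul (c := 1) (Continuous.aestronglyMeasurable (by fun_prop))
      (ae_of_all _ fun x => Real.abs_sin_le_one _)
  rw [← integral_complex_ofReal, ← integral_complex_ofReal, ← integral_mul_const,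
    ← integral_add i1.ofReal (i2.ofReal.mul_const _)]
  congr 1; ext x
  rw [Complex.exp_mul_I]
  push_cast
  ring

theorem charFun_withDensity_ofReal {m : Measure ℝ} {w : ℝ → ℝ} (hw : Integrable w m)
    (hw0 : ∀ᵐ x ∂m, 0 ≤ w x) (t : ℝ) :
    charFun (m.withDensity fun x => ENNReal.ofReal (w x)) t =
      ∫ x, (w x : ℂ) * Complex.exp (t * x * Complex.I) ∂m := by
  rw [charFun_apply_real, integral_withDensity_eq_integral_toReal_smul₀
    hw.1.aemeasurable.ennreal_ofReal (ae_of_all _ fun _ => ENNReal.ofReal_lt_top)]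
  refine integral_congr_ae ?_
  filter_upwards [hw0] with x hx
  rw [ENNReal.toReal_ofReal hx, Complex.real_smul]

theorem withDensity_ofReal_ext {m m' : Measure ℝ} {w w' : ℝ → ℝ} (hw : Integrable w m)
    (hw' : Integrable w' m') (hw0 : ∀ᵐ x ∂m, 0 ≤ w x) (hw0' : ∀ᵐ x ∂m', 0 ≤ w' x)
    (hcos : ∀ t, ∫ x, Real.cos (t * x) * w x ∂m = ∫ x, Real.cos (t * x) * w' x ∂m')
    (hsin : ∀ t, ∫ x, Real.sin (t * x) * w x ∂m = ∫ x, Real.sin (t * x) * w' x ∂m') :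
    (m.withDensity fun x => ENNReal.ofReal (w x)) =
      m'.withDensity fun x => ENNReal.ofReal (w' x) := by
  have := isFiniteMeasure_withDensity_ofReal hw.2
  have := isFiniteMeasure_withDensity_ofReal hw'.2
  refine Measure.ext_of_charFun (funext fun t => ?_)
  rw [charFun_withDensity_ofReal hw hw0, charFun_withDensity_ofReal hw' hw0',
    integral_mul_cexp hw, integral_mul_cexp hw', hcos, hsin]

/-- The integration by parts formula determines `g μ`. -/
theorem withDensity_eq_of_integral_deriv_mul {μ : Measure ℝ} [IsFiniteMeasure μ]
    (h2 : Integrable (fun z => z ^ 2) μ) {g : ℝ → ℝ} (hg : Integrable g μ)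
    (hg0 : ∀ᵐ x ∂μ, 0 ≤ g x)
    (hibp : ∀ (u : ℝ → ℝ) (K : ℝ), ContDiff ℝ (⊤ : ℕ∞) u → u 0 = 0 → (∀ x, ‖deriv u x‖ ≤ K) →
      ∫ z, deriv u z * g z ∂μ = ∫ z, u z * z ∂μ) :
    (μ.withDensity fun x => ENNReal.ofReal (g x)) =
      volume.withDensity fun x => ENNReal.ofReal (upperMoment μ x) := by
  -- It is then enough to use primitives of `cos (t x)` and `sin (t x)` vanishing at `0`; `t = 0` is
  -- separate because the primitives divide by `t`.
  have key : ∀ u : ℝ → ℝ, ContDiff ℝ (⊤ : ℕ∞) u → u 0 = 0 → (∀ x, ‖deriv u x‖ ≤ 1) →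
      ∫ z, deriv u z * g z ∂μ = ∫ x, deriv u x * upperMoment μ x := fun u hu hu0 hu1 => by
    have hc : Continuous (deriv u) := hu.continuous_deriv (by simp)
    rw [hibp u 1 hu hu0 hu1, integral_mul_upperMoment h2 hc hu1]
    congr 1; ext z
    rw [intervalIntegral.integral_deriv_eq_sub
      (fun x _ => hu.differentiable (by simp) x) (hc.intervalIntegrable _ _), hu0, sub_zero]
  refine withDensity_ofReal_ext hg (integrable_upperMoment h2) hg0
    (ae_of_all _ upperMoment_nonneg) (fun t => ?_) (fun t => ?_)
  · obtain ⟨u, hu, hu0, hud⟩ : ∃ u : ℝ → ℝ, ContDiff ℝ (⊤ : ℕ∞) u ∧ u 0 = 0 ∧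
        deriv u = fun x => Real.cos (t * x) := by
      by_cases ht : t = 0
      · exact ⟨fun x => x, contDiff_id, rfl, by ext x; simp [ht]⟩
      · refine ⟨fun x => Real.sin (t * x) / t, by fun_prop, by simp, funext fun x => ?_⟩
        have h := (((hasDerivAt_id x).const_mul t).sin.div_const t).deriv
        simp only [id, mul_one] at h
        rw [h]; field_simp
    have := key u hu hu0 (by rw [hud]; exact fun x => Real.abs_cos_le_one _)
    rwa [hud] at this
  · obtain ⟨u, hu, hu0, hud⟩ : ∃ u : ℝ → ℝ, ContDiff ℝ (⊤ : ℕ∞) u ∧ u 0 = 0 ∧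
        deriv u = fun x => Real.sin (t * x) := by
      by_cases ht : t = 0
      · exact ⟨fun x => 0, contDiff_const, rfl, by ext x; simp [ht]⟩
      · refine ⟨fun x => (1 - Real.cos (t * x)) / t, by fun_prop, by simp, funext fun x => ?_⟩
        have h := ((((hasDerivAt_id x).const_mul t).cos.const_sub 1).div_const t).deriv
        simp only [id, mul_one] at h
        rw [h]; field_simp
    have := key u hu hu0 (by rw [hud]; exact fun x => Real.abs_sin_le_one _)
    rwa [hud] at this

end IdentifyMeasure

/-! ### A linear differential equation with measurable coefficient -/

section LinearODE

/-- The solution of `Ψ' = -w Ψ`, in integrated form, with `w` locally bounded. -/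
theorem eq_mul_exp_neg_integral {Ψ w r : ℝ → ℝ} (hr : Integrable r)
    (hΨ : ∀ x, Ψ x = Ψ 0 - ∫ y in (0 : ℝ)..x, r y) (hrw : ∀ᵐ x : ℝ, r x = w x * Ψ x)
    (hwm : AEStronglyMeasurable w) {c : ℝ} (hc : 0 ≤ c) (hw : ∀ᵐ x : ℝ, ‖w x‖ ≤ c * |x|) (z : ℝ) :
    Ψ z = Ψ 0 * Real.exp (-∫ x in (0 : ℝ)..z, w x) := by
  have hwl : LocallyIntegrable w := by
    refine LocallyIntegrable.mono (f := fun x => c * |x|)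
      (Continuous.locallyIntegrable (by fun_prop)) hwm ?_
    filter_upwards [hw] with x hx
    exact hx.trans (le_abs_self _)
  have hwi : ∀ a b : ℝ, IntervalIntegrable w volume a b := fun a b =>
    intervalIntegrable_iff.2 ((hwl.integrableOn_isCompact isCompact_uIcc).mono_set uIoc_subset_uIcc)
  set A : ℝ → ℝ := fun x => ∫ y in (0 : ℝ)..x, w y with hA
  have hAlip : LipschitzOnWith (c * |z|).toNNReal A (uIcc 0 z) := by
    refine LipschitzOnWith.of_dist_le_mul fun x hx y hy => ?_
    rw [Real.coe_toNNReal _ (by positivity), Real.dist_eq, Real.dist_eq]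
    have h1 : A x - A y = ∫ t in y..x, w t :=
      intervalIntegral.integral_interval_sub_left (hwi 0 x) (hwi 0 y)
    rw [h1, ← Real.norm_eq_abs]
    refine intervalIntegral.norm_integral_le_of_norm_le_const_ae ?_
    filter_upwards [hw] with t ht htm
    refine ht.trans (mul_le_mul_of_nonneg_left ?_ hc)
    have h2 : t ∈ uIcc 0 z := uIcc_subset_uIcc hy hx (uIoc_subset_uIcc htm)
    rcases le_total 0 z with hz | hz
    · rw [uIcc_of_le hz] at h2; rw [abs_of_nonneg h2.1, abs_of_nonneg hz]; exact h2.2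
    · rw [uIcc_of_ge hz] at h2; rw [abs_of_nonpos h2.2, abs_of_nonpos hz]; linarith [h2.1]
  have hexp : AbsolutelyContinuousOnInterval (fun x => Real.exp (A x)) 0 z := by
    obtain ⟨M, hM⟩ := isCompact_uIcc.exists_bound_of_continuousOn hAlip.continuousOn
    obtain ⟨L, hL⟩ := (Real.contDiff_exp (n := 1)).contDiffOn.exists_lipschitzOnWith
      (by decide) (convex_Icc (-M) M) isCompact_Icc
    exact (hL.comp hAlip fun x hx => abs_le.1 (hM x hx)).absolutelyContinuousOnInterval
  have hΨac : AbsolutelyContinuousOnInterval Ψ 0 z := by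
    have h1 := (hr.intervalIntegrable (a := 0) (b := z)).absolutelyContinuousOnInterval_intervalIntegral
      (c := 0) (by simp)
    have h2 : AbsolutelyContinuousOnInterval (fun _ : ℝ => Ψ 0) 0 z :=
      (LipschitzWith.const (Ψ 0)).lipschitzOnWith.absolutelyContinuousOnInterval
    have h3 := h2.sub h1
    have h4 : ((fun _ : ℝ => Ψ 0) - fun x => ∫ y in (0 : ℝ)..x, r y) = Ψ := by
      ext x; rw [hΨ x]; rfl
    rwa [h4] at h3
  -- Integrating factor: as `w` is only measurable, `Ψ exp(A)` is differentiated almost everywhere,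
  -- and absolute continuity makes it constant.
  obtain ⟨C, hC⟩ := (hΨac.fun_mul hexp).const_of_ae_hasDerivAt_zero (by
    filter_upwards [LocallyIntegrable.ae_hasDerivAt_integral hwl,
      LocallyIntegrable.ae_hasDerivAt_integral hr.locallyIntegrable, hrw]
      with x h1 h2 h3 _
    have h4 : HasDerivAt Ψ (-r x) x := by
      have := (h2 0).const_sub (Ψ 0)
      refine this.congr_of_eventuallyEq (Eventually.of_forall fun y => hΨ y)
    have h5 := h4.mul (h1 0).exp
    convert! h5 using 1
    rw [h3]; ring)
  have e0 := hC 0 (by simp)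
  have ez := hC z (by simp)
  have hA0 : A 0 = 0 := by simp [hA]
  rw [hA0, Real.exp_zero, mul_one] at e0
  rw [Real.exp_neg, e0, ← ez, mul_assoc, mul_inv_cancel₀ (Real.exp_pos _).ne', mul_one]

end LinearODE

/-! ### The density and its formula -/

section Density

variable {μ : Measure ℝ} {ρ g : ℝ → ℝ}

theorem exists_density_of_absolutelyContinuous [IsFiniteMeasure μ] (h : μ ≪ volume) :
    ∃ ρ : ℝ → ℝ, Measurable ρ ∧ (∀ z, 0 ≤ ρ z) ∧
      μ = (volume : Measure ℝ).withDensity fun z => ENNReal.ofReal (ρ z) := by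
  refine ⟨fun z => (μ.rnDeriv volume z).toReal, (Measure.measurable_rnDeriv _ _).ennreal_toReal,
    fun _ => ENNReal.toReal_nonneg, ?_⟩
  conv_lhs => rw [← Measure.withDensity_rnDeriv_eq μ volume h]
  refine withDensity_congr_ae ?_
  filter_upwards [Measure.rnDeriv_lt_top μ volume] with x hx
  rw [ENNReal.ofReal_toReal hx.ne]

/-- If `g` is bounded below and `g μ` has a density, then `μ` is absolutely continuous. -/
theorem absolutelyContinuous_of_withDensity_eq {Ψ : ℝ → ℝ} (hg : Measurable g) {σ : ℝ} (hσ : 0 < σ)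
    (hgσ : ∀ᵐ x ∂μ, σ ^ 2 ≤ g x)
    (heq : (μ.withDensity fun x => ENNReal.ofReal (g x)) =
      volume.withDensity fun x => ENNReal.ofReal (Ψ x)) : μ ≪ volume := by
  have h1 : μ ≪ μ.withDensity fun x => ENNReal.ofReal (g x) := by
    refine withDensity_absolutelyContinuous' hg.ennreal_ofReal.aemeasurable ?_
    filter_upwards [hgσ] with x hx
    rw [Ne, ENNReal.ofReal_eq_zero, not_le]
    exact (by positivity : 0 < σ ^ 2).trans_le hx
  rw [heq] at h1
  exact h1.trans (withDensity_absolutelyContinuous _ _)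

/-- The positive and negative parts of a centered law have equal first moments. -/
theorem upperMoment_zero_eq (h1 : Integrable (fun z => z) μ) (h0 : ∫ z, z ∂μ = 0) :
    upperMoment μ 0 = (∫ z, |z| ∂μ) / 2 := by
  have ha : ∫ z, |z| ∂μ = ∫ z in Ici 0, z ∂μ + ∫ z in (Ici 0)ᶜ, -z ∂μ := by
    rw [← integral_add_compl (measurableSet_Ici (a := (0 : ℝ))) h1.abs]
    congr 1
    · exact setIntegral_congr_fun measurableSet_Ici fun z hz => abs_of_nonneg hz
    · refine setIntegral_congr_fun measurableSet_Ici.compl fun z hz => abs_of_nonpos ?_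
      simp only [compl_Ici, mem_Iio] at hz
      exact hz.le
  have hb := integral_add_compl (measurableSet_Ici (a := (0 : ℝ))) h1
  rw [h0] at hb
  rw [integral_neg] at ha
  rw [upperMoment_eq_setIntegral h1 h0]
  linarith

theorem integral_abs_pos [IsProbabilityMeasure μ] (hac : μ ≪ volume)
    (h1 : Integrable (fun z => z) μ) : 0 < ∫ z, |z| ∂μ := by
  rw [integral_pos_iff_support_of_nonneg (fun z => abs_nonneg z) h1.abs]
  have hs : Function.support (fun z : ℝ => |z|) = {0}ᶜ := by ext; simp
  have h0 : μ {(0 : ℝ)} = 0 := hac (by simp)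
  rw [hs, prob_compl_eq_one_sub (measurableSet_singleton _), h0]
  simp

variable (hρ : Measurable ρ) (hρ0 : ∀ z, 0 ≤ ρ z)
  (hμ : μ = (volume : Measure ℝ).withDensity fun z => ENNReal.ofReal (ρ z))

include hρ hρ0 hμ

theorem integral_eq_of_density (f : ℝ → ℝ) : ∫ x, f x ∂μ = ∫ x, f x * ρ x := by
  rw [hμ, integral_withDensity_eq_integral_toReal_smul hρ.ennreal_ofReal
    (ae_of_all _ fun _ => ENNReal.ofReal_lt_top)]
  congr 1; ext x
  rw [ENNReal.toReal_ofReal (hρ0 x), smul_eq_mul, mul_comm]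

theorem setIntegral_eq_of_density (f : ℝ → ℝ) {s : Set ℝ} (hs : MeasurableSet s) :
    ∫ x in s, f x ∂μ = ∫ x in s, f x * ρ x := by
  rw [← integral_indicator hs, integral_eq_of_density hρ hρ0 hμ, ← integral_indicator hs]
  congr 1; ext x
  by_cases hx : x ∈ s <;> simp [hx]

theorem integrable_iff_of_density {f : ℝ → ℝ} :
    Integrable f μ ↔ Integrable fun x => f x * ρ x := by
  rw [hμ, integrable_withDensity_iff_integrable_smul' hρ.ennreal_ofReal
    (ae_of_all _ fun _ => ENNReal.ofReal_lt_top)]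
  refine integrable_congr (ae_of_all _ fun x => ?_)
  simp only
  rw [ENNReal.toReal_ofReal (hρ0 x), smul_eq_mul, mul_comm]

theorem ae_iff_of_density {p : ℝ → Prop} : (∀ᵐ x ∂μ, p x) ↔ ∀ᵐ x : ℝ, ρ x ≠ 0 → p x := by
  rw [hμ, ae_withDensity_iff hρ.ennreal_ofReal]
  simp only [Ne, ENNReal.ofReal_eq_zero, not_le]
  refine eventually_congr (ae_of_all _ fun x => ?_)
  rw [(hρ0 x).lt_iff_ne', Ne]

theorem mul_density_ae_eq_upperMoment [IsFiniteMeasure μ]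
    (hg : Measurable g) (hg0 : ∀ᵐ x ∂μ, 0 ≤ g x)
    (heq : (μ.withDensity fun x => ENNReal.ofReal (g x)) =
      volume.withDensity fun x => ENNReal.ofReal (upperMoment μ x)) :
    ∀ᵐ x : ℝ, g x * ρ x = upperMoment μ x := by
  have h1 : (μ.withDensity fun x => ENNReal.ofReal (g x)) = volume.withDensity
      ((fun x => ENNReal.ofReal (ρ x)) * fun x => ENNReal.ofReal (g x)) := by
    rw [withDensity_mul _ hρ.ennreal_ofReal hg.ennreal_ofReal, ← hμ]
  rw [h1] at heq
  have h3 := (withDensity_eq_iff_of_sigmaFinite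
    (hρ.ennreal_ofReal.mul hg.ennreal_ofReal).aemeasurable
    measurable_upperMoment.ennreal_ofReal.aemeasurable).1 heq
  filter_upwards [h3, (ae_iff_of_density hρ hρ0 hμ).1 hg0] with x hx hx0
  rw [Pi.mul_apply, ← ENNReal.ofReal_mul (hρ0 x)] at hx
  -- Where `ρ` vanishes nothing is known about the sign of `g`, but the equality of densities still
  -- forces `Ψ x = 0`.
  by_cases h : ρ x = 0
  · rw [h, zero_mul, ENNReal.ofReal_zero] at hx
    have := ENNReal.ofReal_eq_zero.1 hx.symm
    rw [h, mul_zero]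
    exact le_antisymm (upperMoment_nonneg x) this
  · rw [ENNReal.ofReal_eq_ofReal_iff (mul_nonneg (hρ0 x) (hx0 h)) (upperMoment_nonneg x)] at hx
    rw [← hx, mul_comm]

theorem upperMoment_eq_integral_Ioi (h1 : Integrable (fun z => z) μ) (h0 : ∫ z, z ∂μ = 0)
    (x : ℝ) : upperMoment μ x = ∫ y in Ioi x, y * ρ y := by
  rw [upperMoment_eq_setIntegral h1 h0,
    setIntegral_eq_of_density hρ hρ0 hμ _ measurableSet_Ici, integral_Ici_eq_integral_Ioi]

/-- The formula for the density in terms of the kernel `g`. -/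
theorem density_formula [IsProbabilityMeasure μ]
    (h1 : Integrable (fun z => z) μ) (h0 : ∫ z, z ∂μ = 0) (hg : Measurable g) {σ : ℝ}
    (hσ : 0 < σ) (hgσ : ∀ᵐ x ∂μ, σ ^ 2 ≤ g x)
    (heq : (μ.withDensity fun x => ENNReal.ofReal (g x)) =
      volume.withDensity fun x => ENNReal.ofReal (upperMoment μ x)) :
    (∀ᵐ x : ℝ, 0 < ρ x ∧ σ ^ 2 ≤ g x) ∧ (∀ z, upperMoment μ z =
      (∫ z, |z| ∂μ) / 2 * Real.exp (-∫ x in (0 : ℝ)..z, x / g x)) := by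
  have hσ2 : 0 < σ ^ 2 := by positivity
  have hgρ := mul_density_ae_eq_upperMoment hρ hρ0 hμ hg
    (hgσ.mono fun x hx => hσ2.le.trans hx) heq
  have hgσ' := (ae_iff_of_density hρ hρ0 hμ).1 hgσ
  have hr : Integrable fun y => y * ρ y := (integrable_iff_of_density hρ hρ0 hμ).1 h1
  -- The lower bound on `g` is so far known only where `ρ ≠ 0`, so the coefficient is set to zero
  -- elsewhere. The equation survives, since its other side `x * ρ x` vanishes there too.
  set w : ℝ → ℝ := fun x => if ρ x = 0 then 0 else x / g x with hw
  have hwm : Measurable w :=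
    Measurable.ite (hρ (measurableSet_singleton 0)) measurable_const (measurable_id.div hg)
  have hode := eq_mul_exp_neg_integral (Ψ := upperMoment μ) (w := w) (r := fun y => y * ρ y) hr
    (fun x => by
      rw [upperMoment_eq_integral_Ioi hρ hρ0 hμ h1 h0, upperMoment_eq_integral_Ioi hρ hρ0 hμ h1 h0,
        intervalIntegral.integral_Ioi_sub_Ioi' hr.integrableOn hr.integrableOn |>.symm]
      ring)
    (by
      filter_upwards [hgρ, hgσ'] with x hx hx'
      simp only [hw]
      split_ifs with h
      · simp [h]
      · have : g x ≠ 0 := (hσ2.trans_le (hx' h)).ne'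
        rw [← hx]; field_simp)
    hwm.aestronglyMeasurable (c := (σ ^ 2)⁻¹) (by positivity)
    (by
      filter_upwards [hgσ'] with x hx'
      simp only [hw]
      split_ifs with h
      · rw [norm_zero]; positivity
      · have hgx := hx' h
        rw [norm_div, Real.norm_eq_abs, Real.norm_of_nonneg (hσ2.le.trans hgx), div_eq_inv_mul]
        gcongr)
  have hpos : ∀ z, 0 < upperMoment μ z := fun z => by
    rw [hode z, upperMoment_zero_eq h1 h0]
    have := integral_abs_pos (hμ ▸ withDensity_absolutelyContinuous _ _) h1
    positivity
  -- Since `g ρ = Ψ > 0`, the exceptional set is null, and `w` may be replaced by `x / g x`.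
  have hall : ∀ᵐ x : ℝ, 0 < ρ x ∧ σ ^ 2 ≤ g x := by
    filter_upwards [hgρ, hgσ'] with x hx hx'
    have hne : ρ x ≠ 0 := fun h => by
      have := hpos x
      rw [← hx, h, mul_zero] at this
      exact lt_irrefl _ this
    exact ⟨(hρ0 x).lt_of_ne' hne, hx' hne⟩
  refine ⟨hall, fun z => ?_⟩
  rw [hode z, upperMoment_zero_eq h1 h0]
  congr 3
  refine intervalIntegral.integral_congr_ae ?_
  filter_upwards [hall] with x hx _
  simp only [hw]
  rw [if_neg hx.1.ne']

end Density

end GaussDensity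

end

/-! ### The main theorem -/

theorem theorem3p1
    {H : Type*} [NormedAddCommGroup H] [InnerProductSpace ℝ H] [CompleteSpace H]
    [TopologicalSpace.SeparableSpace H]
    {Ω : Type*} [MeasurableSpace Ω] (P : Measure Ω) [IsProbabilityMeasure P]
    (X : H → Ω → ℝ) (hX : GaussDensity.IsIsonormal X P)
    (Z : Ω → ℝ) (hZm : Measurable Z) (hZ2 : MemLp Z 2 P)
    (hZD : hZ2.toLp Z ∈ GaussDensity.D12 X P)
    (hZ0 : ∫ ω, Z ω ∂P = 0)
    (g : ℝ → ℝ)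
    (hg : GaussDensity.IsCondExpGiven P (GaussDensity.steinInner X P (hZ2.toLp Z)) Z g)
    (σ : ℝ) (hσ : 0 < σ) (hgσ : ∀ᵐ ω ∂P, σ ^ 2 ≤ g (Z ω)) :
    (∃ ρ : ℝ → ℝ, GaussDensity.IsDensity P Z ρ) ∧
    (P.map Z).support = Set.univ ∧
    ∀ ρ : ℝ → ℝ, GaussDensity.IsDensity P Z ρ →
      (∀ z : ℝ, IntervalIntegrable (fun x => x / g x) volume 0 z) ∧
      (∀ᵐ z : ℝ, 0 < g z ∧
        ρ z = (∫ ω, |Z ω| ∂P) / (2 * g z) * Real.exp (-∫ x in (0 : ℝ)..z, x / g x)) ∧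
      Integrable (fun y => y * ρ y) ∧
      (∀ᵐ ω ∂P, 0 < ρ (Z ω) ∧ g (Z ω) = (∫ y in Set.Ioi (Z ω), y * ρ y) / ρ (Z ω)) := by

  set μ := P.map Z with hμ
  have : IsProbabilityMeasure μ := Measure.isProbabilityMeasure_map hZm.aemeasurable
  have hg' := hg.1
  have hmap : ∀ f : ℝ → ℝ, Measurable f → ∫ x, f x ∂μ = ∫ ω, f (Z ω) ∂P := fun f hf =>
    integral_map hZm.aemeasurable hf.aestronglyMeasurable
  have h1 : Integrable (fun z : ℝ => z) μ :=
    (integrable_map_measure measurable_id.aestronglyMeasurable hZm.aemeasurable).2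
      (hZ2.integrable (by simp))
  have h2 : Integrable (fun z : ℝ => z ^ 2) μ :=
    (integrable_map_measure (by fun_prop) hZm.aemeasurable).2 hZ2.integrable_sq
  have h0 : ∫ z, z ∂μ = 0 := (hmap _ measurable_id).trans hZ0
  have habs : ∫ z, |z| ∂μ = ∫ ω, |Z ω| ∂P := hmap _ (by fun_prop)
  have hgi : Integrable g μ :=
    (integrable_map_measure hg'.aestronglyMeasurable hZm.aemeasurable).2
      (integrable_condExp.congr hg.2.symm)
  have hgσ' : ∀ᵐ x ∂μ, σ ^ 2 ≤ g x :=
    (ae_map_iff hZm.aemeasurable (measurableSet_le measurable_const hg')).2 hgσ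
  have heq := GaussDensity.withDensity_eq_of_integral_deriv_mul h2 hgi
    (hgσ'.mono fun x hx => (sq_nonneg σ).trans hx) fun u K hu hu0 hK => by
      rw [hmap (fun z => deriv u z * g z) ((hu.continuous_deriv (by simp)).measurable.mul hg'),
        hmap (fun z => u z * z) (hu.continuous.measurable.mul measurable_id)]
      exact GaussDensity.integral_deriv_mul_condExp hX hZm hZ2 hZD hZ0 hg hu hu0 hK
  have hac := GaussDensity.absolutelyContinuous_of_withDensity_eq hg' hσ hgσ' heq
  obtain ⟨ρ₀, hρ₀⟩ : ∃ ρ : ℝ → ℝ, GaussDensity.IsDensity P Z ρ :=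
    GaussDensity.exists_density_of_absolutelyContinuous hac
  refine ⟨⟨ρ₀, hρ₀⟩, ?_, fun ρ hρ => ?_⟩
  · obtain ⟨hall, -⟩ := GaussDensity.density_formula hρ₀.1 hρ₀.2.1 hρ₀.2.2 h1 h0 hg' hσ hgσ' heq
    -- Positivity of the density almost everywhere makes a `μ`-null neighbourhood Lebesgue null,
    -- which is impossible.
    have hac' : volume ≪ μ := by
      rw [hμ, hρ₀.2.2]
      refine withDensity_absolutelyContinuous' hρ₀.1.ennreal_ofReal.aemeasurable ?_
      filter_upwards [hall] with x hx
      simpa using hx.1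
    refine eq_univ_of_forall fun x => ?_
    rw [Measure.mem_support_iff_forall]
    intro U hU
    refine pos_iff_ne_zero.2 fun h => ?_
    exact (Measure.measure_pos_of_mem_nhds volume hU).ne' (hac' h)
  · obtain ⟨hall, hform⟩ := GaussDensity.density_formula hρ.1 hρ.2.1 hρ.2.2 h1 h0 hg' hσ hgσ' heq
    have hgρ := GaussDensity.mul_density_ae_eq_upperMoment hρ.1 hρ.2.1 hρ.2.2 hg'
      (hgσ'.mono fun x hx => (sq_nonneg σ).trans hx) heq
    have hσ2 : 0 < σ ^ 2 := by positivity
    refine ⟨fun z => ?_, ?_, (GaussDensity.integrable_iff_of_density hρ.1 hρ.2.1 hρ.2.2).1 h1, ?_⟩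
    -- The bound `g ≥ σ²`, now valid Lebesgue almost everywhere, dominates `x / g x`.
    · refine IntervalIntegrable.mono_fun (f := fun x => (σ ^ 2)⁻¹ * |x|)
        (Continuous.intervalIntegrable (by fun_prop) _ _)
        (measurable_id.div hg').aestronglyMeasurable (ae_restrict_of_ae ?_)
      filter_upwards [hall] with x hx
      rw [norm_div, norm_mul, norm_inv, Real.norm_of_nonneg hσ2.le,
        Real.norm_of_nonneg (hσ2.le.trans hx.2), div_eq_inv_mul, Real.norm_eq_abs, Real.norm_eq_abs,
        abs_abs]
      gcongr
      exact hx.2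
    · filter_upwards [hall, hgρ] with z hz hz'
      have hgz := hσ2.trans_le hz.2
      refine ⟨hgz, ?_⟩
      rw [hform, habs] at hz'
      field_simp
      field_simp at hz'
      linarith
    · refine ae_of_ae_map hZm.aemeasurable (p := fun z => 0 < ρ z ∧
        g z = (∫ y in Set.Ioi z, y * ρ y) / ρ z) (hac.ae_le ?_)
      filter_upwards [hall, hgρ] with z hz hz'
      refine ⟨hz.1, ?_⟩
      rw [eq_div_iff hz.1.ne', hz',
        GaussDensity.upperMoment_eq_integral_Ioi hρ.1 hρ.2.1 hρ.2.2 h1 h0]
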